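/- Let $(X,\mathcal B,\mu)$ be a standard probability space with non-atomic measure $\mu$, and let $\mathrm{Aut}$ be the group of its invertible measure-preserving transformations (identified when they coincide $\mu$-almost everywhere). Let $\{A_i\}_{i\ge 0}$ be a sequence of measurable sets that is dense in $\mathcal B$ with respect to the distance $\mu(A\,\Delta\,B)$, and equip $\mathrm{Aut}$ with the Halmos metric $$\rho(S,T)=\sum_{i\ge 0} 2^{-i}\bigl(\mu(SA_i\,\Delta\,TA_i)+\mu(S^{-1}A_i\,\Delta\,T^{-1}A_i)\bigr).$$ A subset of $\mathrm{Aut}$ is called generic if it contains a dense $G_\delta$ subset of $(\mathrm{Aut},\rho)$. Let $K\subset\mathrm{Aut}$ be a compact set all of whose elements have zero Kolmogorov–Sinai entropy. Then the set $$K^{\mathrm{Aut}}=\{J^{-1}SJ:\ S\in K,\ J\in\mathrm{Aut}\}$$ of all transformations conjugate to elements of $K$ is of first category in $(\mathrm{Aut},\rho)$; in particular, it is not generic. -/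

import Mathlib

open MeasureTheory Filter

noncomputable section

namespace HalmosAut

variable {X : Type*} [MeasurableSpace X]

/-- The group of invertible bimeasurable transformations of `X` that preserve `μ`
(pointwise defined; multiplication is composition). -/
def MPGroup (μ : Measure X) : Subgroup (Equiv.Perm X) where
  carrier := {e | MeasurePreserving e μ μ ∧ MeasurePreserving e.symm μ μ}
  one_mem' := ⟨MeasurePreserving.id μ, MeasurePreserving.id μ⟩
  mul_mem' := fun ha hb => ⟨ha.1.comp hb.1, hb.2.comp ha.2⟩
  inv_mem' := fun ha => ⟨ha.2, ha.1⟩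

/-- The transformations that are equal to the identity almost everywhere. -/
def nullGroup (μ : Measure X) : Subgroup (MPGroup μ) where
  carrier := {e | ∀ᵐ x ∂μ, e.1 x = x}
  one_mem' := by
    change ∀ᵐ x ∂μ, (1 : Equiv.Perm X) x = x
    exact Eventually.of_forall fun _ => rfl
  mul_mem' := by
    intro a b ha hb
    change ∀ᵐ x ∂μ, a.1 (b.1 x) = x
    filter_upwards [b.2.1.quasiMeasurePreserving.ae ha, hb] with x h1 h2
    exact h1.trans h2
  inv_mem' := by
    intro a ha
    change ∀ᵐ x ∂μ, a.1.symm x = x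
    filter_upwards [a.2.2.quasiMeasurePreserving.ae ha] with x h1
    exact h1.symm.trans (a.1.apply_symm_apply x)

instance nullGroup_normal (μ : Measure X) : (nullGroup μ).Normal where
  conj_mem := by
    intro n hn g
    have h : ∀ᵐ x ∂μ, n.1 (g.1.symm x) = g.1.symm x := g.2.2.quasiMeasurePreserving.ae hn
    change ∀ᵐ x ∂μ, g.1 (n.1 (g.1.symm x)) = x
    filter_upwards [h] with x h1
    rw [h1]
    exact g.1.apply_symm_apply x

/-- `Aut(X, μ)`: the invertible measure-preserving transformations, identified when they agree
almost everywhere, with composition as group law. -/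
abbrev Aut (μ : Measure X) : Type _ := MPGroup μ ⧸ nullGroup μ

theorem ae_eq_of_rel {μ : Measure X} {s t : MPGroup μ}
    (h : QuotientGroup.leftRel (nullGroup μ) s t) : ∀ᵐ x ∂μ, s.1 x = t.1 x := by
  have h' : ∀ᵐ x ∂μ, s.1.symm (t.1 x) = x := QuotientGroup.leftRel_apply.1 h
  filter_upwards [h'] with x hx
  exact ((Equiv.symm_apply_eq _).1 hx).symm

theorem ae_symm_eq {μ : Measure X} {s t : MPGroup μ}
    (h : ∀ᵐ x ∂μ, s.1 x = t.1 x) : ∀ᵐ x ∂μ, s.1.symm x = t.1.symm x := by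
  filter_upwards [s.2.2.quasiMeasurePreserving.ae h] with x hx
  rw [Equiv.apply_symm_apply] at hx
  exact (Equiv.eq_symm_apply _).2 hx.symm

/-! ### The Halmos metric -/

/-- A sequence of measurable sets that is dense in the algebra of measurable sets with respect to
the distance `μ (A ∆ B)`. -/
structure DenseFamily (μ : Measure X) where
  /-- The sets of the family. -/
  set : ℕ → Set X
  measurableSet : ∀ i, MeasurableSet (set i)
  dense : ∀ B : Set X, MeasurableSet B → ∀ ε : ℝ, 0 < ε → ∃ i, μ.real (symmDiff (set i) B) < ε

/-- `μ(SA ∆ TA) + μ(S⁻¹A ∆ T⁻¹A)` for pointwise defined transformations. -/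
def setDist (μ : Measure X) (A : Set X) (s t : MPGroup μ) : ℝ :=
  μ.real (symmDiff (s.1 '' A) (t.1 '' A)) +
    μ.real (symmDiff (s.1.symm '' A) (t.1.symm '' A))

/-- `∑ᵢ 2⁻ⁱ (μ(SAᵢ ∆ TAᵢ) + μ(S⁻¹Aᵢ ∆ T⁻¹Aᵢ))` for pointwise defined transformations. -/
def preDist {μ : Measure X} (A : DenseFamily μ) (s t : MPGroup μ) : ℝ :=
  ∑' i : ℕ, (1 / 2 : ℝ) ^ i * setDist μ (A.set i) s t

theorem image_ae_eq {μ : Measure X} {s t : MPGroup μ} (h : ∀ᵐ x ∂μ, s.1 x = t.1 x) (A : Set X) :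
    (s.1 '' A : Set X) =ᵐ[μ] (t.1 '' A : Set X) := by
  rw [Equiv.image_eq_preimage_symm, Equiv.image_eq_preimage_symm]
  filter_upwards [ae_symm_eq h] with x hx
  change (s.1.symm x ∈ A) = (t.1.symm x ∈ A)
  rw [hx]

theorem symm_image_ae_eq {μ : Measure X} {s t : MPGroup μ} (h : ∀ᵐ x ∂μ, s.1 x = t.1 x)
    (A : Set X) : (s.1.symm '' A : Set X) =ᵐ[μ] (t.1.symm '' A : Set X) := by
  rw [Equiv.image_symm_eq_preimage, Equiv.image_symm_eq_preimage]
  filter_upwards [h] with x hx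
  change (s.1 x ∈ A) = (t.1 x ∈ A)
  rw [hx]

theorem preDist_congr {μ : Measure X} (A : DenseFamily μ) {s t s' t' : MPGroup μ}
    (hs : ∀ᵐ x ∂μ, s.1 x = s'.1 x) (ht : ∀ᵐ x ∂μ, t.1 x = t'.1 x) :
    preDist A s t = preDist A s' t' := by
  unfold preDist setDist
  congr 1
  funext i
  congr 2
  · exact measureReal_congr ((image_ae_eq hs _).symmDiff (image_ae_eq ht _))
  · exact measureReal_congr ((symm_image_ae_eq hs _).symmDiff (symm_image_ae_eq ht _))

/-- The Halmos distance on `Aut(X, μ)`. -/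
def halmosDist {μ : Measure X} (A : DenseFamily μ) (S T : Aut μ) : ℝ :=
  Quotient.liftOn₂ S T (preDist A) fun _ _ _ _ hs ht =>
    preDist_congr A (ae_eq_of_rel hs) (ae_eq_of_rel ht)

theorem setDist_nonneg (μ : Measure X) (A : Set X) (s t : MPGroup μ) : 0 ≤ setDist μ A s t :=
  add_nonneg measureReal_nonneg measureReal_nonneg

theorem summable_preDist {μ : Measure X} [IsProbabilityMeasure μ] (A : DenseFamily μ)
    (s t : MPGroup μ) : Summable fun i : ℕ => (1 / 2 : ℝ) ^ i * setDist μ (A.set i) s t := by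
  refine Summable.of_nonneg_of_le (fun i => mul_nonneg (by positivity) (setDist_nonneg _ _ _ _))
    (fun i => ?_) (summable_geometric_two.mul_right 2)
  refine mul_le_mul_of_nonneg_left ?_ (by positivity)
  have h1 := measureReal_le_one (μ := μ) (s := symmDiff (s.1 '' A.set i) (t.1 '' A.set i))
  have h2 := measureReal_le_one (μ := μ)
    (s := symmDiff (s.1.symm '' A.set i) (t.1.symm '' A.set i))
  unfold setDist
  linarith

theorem measureReal_symmDiff_triangle (μ : Measure X) [IsProbabilityMeasure μ] (A B C : Set X) :
    μ.real (symmDiff A C) ≤ μ.real (symmDiff A B) + μ.real (symmDiff B C) :=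
  (measureReal_mono (symmDiff_triangle A B C)).trans (measureReal_union_le _ _)

theorem setDist_triangle (μ : Measure X) [IsProbabilityMeasure μ] (A : Set X)
    (s t u : MPGroup μ) : setDist μ A s u ≤ setDist μ A s t + setDist μ A t u := by
  have h1 := measureReal_symmDiff_triangle μ (s.1 '' A) (t.1 '' A) (u.1 '' A)
  have h2 := measureReal_symmDiff_triangle μ (s.1.symm '' A) (t.1.symm '' A) (u.1.symm '' A)
  unfold setDist
  linarith

theorem measureReal_symm_image {μ : Measure X} (s : MPGroup μ) {B : Set X}
    (hB : MeasurableSet B) : μ.real (s.1.symm '' B) = μ.real B := by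
  rw [Equiv.image_symm_eq_preimage]
  exact s.2.1.measureReal_preimage hB.nullMeasurableSet

theorem ae_eq_of_preDist_eq_zero {μ : Measure X} [StandardBorelSpace X] [IsProbabilityMeasure μ]
    (A : DenseFamily μ) {s t : MPGroup μ} (h : preDist A s t = 0) :
    ∀ᵐ x ∂μ, s.1 x = t.1 x := by
  have hA : ∀ i, μ.real (symmDiff (s.1.symm '' A.set i) (t.1.symm '' A.set i)) = 0 := by
    intro i
    have hs : HasSum (fun i : ℕ => (1 / 2 : ℝ) ^ i * setDist μ (A.set i) s t) 0 := by
      rw [← h]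
      exact (summable_preDist A s t).hasSum
    have hp : ∀ i : ℕ, 0 ≤ (1 / 2 : ℝ) ^ i * setDist μ (A.set i) s t :=
      fun i => mul_nonneg (by positivity) (setDist_nonneg μ (A.set i) s t)
    have h0 := (hasSum_zero_iff_of_nonneg hp).1 hs
    have h1 := congrFun h0 i
    have h2 : setDist μ (A.set i) s t = 0 := by simpa using h1
    unfold setDist at h2
    have h3 : 0 ≤ μ.real (symmDiff (s.1 '' A.set i) (t.1 '' A.set i)) := measureReal_nonneg
    have h4 : 0 ≤ μ.real (symmDiff (s.1.symm '' A.set i) (t.1.symm '' A.set i)) :=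
      measureReal_nonneg
    linarith
  refine Filter.EventuallyEq.of_forall_separating_preimage (l := ae μ) MeasurableSet
    fun U hU => ?_
  rw [← measure_symmDiff_eq_zero_iff, ← measureReal_eq_zero_iff]
  refine le_antisymm (le_of_forall_pos_le_add fun ε hε => ?_) measureReal_nonneg
  obtain ⟨i, hi⟩ := A.dense U hU (ε / 2) (by positivity)
  have hd := (A.measurableSet i).symmDiff hU
  have e1 : μ.real (symmDiff (s.1.symm '' A.set i) (s.1.symm '' U)) < ε / 2 := by
    rw [← Set.image_symmDiff s.1.symm.injective, measureReal_symm_image s hd]; exact hi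
  have e2 : μ.real (symmDiff (t.1.symm '' A.set i) (t.1.symm '' U)) < ε / 2 := by
    rw [← Set.image_symmDiff t.1.symm.injective, measureReal_symm_image t hd]; exact hi
  have t1 := measureReal_symmDiff_triangle μ (s.1.symm '' U) (s.1.symm '' A.set i)
    (t.1.symm '' U)
  have t2 := measureReal_symmDiff_triangle μ (s.1.symm '' A.set i) (t.1.symm '' A.set i)
    (t.1.symm '' U)
  rw [symmDiff_comm] at e1
  have e0 := hA i
  rw [Equiv.image_symm_eq_preimage, Equiv.image_symm_eq_preimage] at t1
  rw [Equiv.image_symm_eq_preimage] at e1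
  rw [Equiv.image_symm_eq_preimage t.1 U] at e2
  rw [Equiv.image_symm_eq_preimage t.1 U] at t2
  linarith

/-- `Aut(X, μ)` as a metric space under the Halmos metric given by a dense family of sets. -/
@[reducible] def halmosMetricSpace {μ : Measure X} [StandardBorelSpace X] [IsProbabilityMeasure μ]
    (A : DenseFamily μ) : MetricSpace (Aut μ) where
  dist := halmosDist A
  dist_self := by
    rintro ⟨s⟩
    change preDist A s s = 0
    simp [preDist, setDist]
  dist_comm := by
    rintro ⟨s⟩ ⟨t⟩
    change preDist A s t = preDist A t s
    simp [preDist, setDist, symmDiff_comm]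
  dist_triangle := by
    rintro ⟨s⟩ ⟨t⟩ ⟨u⟩
    change preDist A s u ≤ preDist A s t + preDist A t u
    unfold preDist
    rw [← (summable_preDist A s t).tsum_add (summable_preDist A t u)]
    refine (summable_preDist A s u).tsum_le_tsum (fun i => ?_)
      ((summable_preDist A s t).add (summable_preDist A t u))
    rw [← mul_add]
    exact mul_le_mul_of_nonneg_left (setDist_triangle μ _ s t u) (by positivity)
  eq_of_dist_eq_zero := by
    rintro ⟨s⟩ ⟨t⟩ h
    refine QuotientGroup.eq.2 ?_
    change ∀ᵐ x ∂μ, s.1.symm (t.1 x) = x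
    filter_upwards [ae_eq_of_preDist_eq_zero A h] with x hx
    rw [← hx]
    exact s.1.symm_apply_apply x

/-! ### Kolmogorov–Sinai entropy -/

/-- Shannon entropy `-∑ μ(C) ln μ(C)` of the finite partition of `X` into the fibres of `ξ`. -/
def partitionEntropy {α : Type*} [Fintype α] (μ : Measure X) (ξ : X → α) : ℝ :=
  ∑ a : α, Real.negMulLog (μ.real (ξ ⁻¹' {a}))

/-- The label of the join `ξ ∨ T⁻¹ξ ∨ ⋯ ∨ T⁻⁽ⁿ⁻¹⁾ξ`, where `ξ` is a finite partition given by its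
labelling function. -/
def itinerary {k : ℕ} (T : X → X) (ξ : X → Fin k) (n : ℕ) : X → (Fin n → Fin k) :=
  fun x i => ξ (T^[i] x)

/-- `h(T, ξ) = lim (1/n) H(ξ ∨ T⁻¹ξ ∨ ⋯ ∨ T⁻⁽ⁿ⁻¹⁾ξ)`, written as an upper limit. -/
def entropyWrt {k : ℕ} (μ : Measure X) (T : X → X) (ξ : X → Fin k) : ENNReal :=
  limsup (fun n : ℕ => ENNReal.ofReal (partitionEntropy μ (itinerary T ξ n) / n)) atTop

/-- The entropy of a map: supremum of `h(T, ξ)` over all finite measurable partitions `ξ`. -/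
def mapEntropy (μ : Measure X) (T : X → X) : ENNReal :=
  ⨆ (k : ℕ) (ξ : X → Fin k) (_ : Measurable ξ), entropyWrt μ T ξ

theorem mapEntropy_congr {μ : Measure X} {s t : MPGroup μ} (h : ∀ᵐ x ∂μ, s.1 x = t.1 x) :
    mapEntropy μ s.1 = mapEntropy μ t.1 := by
  have hit : ∀ n : ℕ, ∀ᵐ x ∂μ, s.1^[n] x = t.1^[n] x := by
    intro n
    induction n with
    | zero => exact Eventually.of_forall fun _ => rfl
    | succ n ih =>
      filter_upwards [h, t.2.1.quasiMeasurePreserving.ae ih] with x h1 h2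
      rw [Function.iterate_succ_apply, Function.iterate_succ_apply, h1, h2]
  have key : ∀ (k : ℕ) (ξ : X → Fin k), entropyWrt μ s.1 ξ = entropyWrt μ t.1 ξ := by
    intro k ξ
    unfold entropyWrt partitionEntropy
    congr 1
    funext n
    congr 2
    refine Finset.sum_congr rfl fun a _ => ?_
    congr 1
    refine measureReal_congr ?_
    filter_upwards [ae_all_iff.2 hit] with x hx
    have : itinerary s.1 ξ n x = itinerary t.1 ξ n x := by
      funext i
      simp only [itinerary, hx]
    change (itinerary s.1 ξ n x = a) = (itinerary t.1 ξ n x = a)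
    rw [this]
  simp only [mapEntropy, key]

/-- Kolmogorov–Sinai entropy of an element of `Aut(X, μ)`. -/
def ksEntropy {μ : Measure X} (S : Aut μ) : ENNReal :=
  Quotient.liftOn S (fun s => mapEntropy μ s.1) fun _ _ h => mapEntropy_congr (ae_eq_of_rel h)

/-! ### Conjugacy saturation and genericity -/

/-- `K^Aut = {J⁻¹ S J : S ∈ K, J ∈ Aut}`. -/
def conjSaturation {μ : Measure X} (K : Set (Aut μ)) : Set (Aut μ) :=
  {T | ∃ S ∈ K, ∃ J : Aut μ, T = J⁻¹ * S * J}

/-- A set is generic if it contains a dense `Gδ` set. -/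
def IsGeneric {Y : Type*} [TopologicalSpace Y] (s : Set Y) : Prop :=
  ∃ G ⊆ s, IsGδ G ∧ Dense G

end HalmosAut

end

open HalmosAut

open MeasureTheory Filter HalmosAut

noncomputable section

namespace HalmosAut

variable {X : Type*} [MeasurableSpace X]

/-! ### Shannon entropy of finite partitions -/

/-! The invariant is the growth of entropy along sparse progressions. For a set B, a power q = j + 1
and a length L j, consider the entropy of the itinerary of {B, Bᶜ} under T^q over L j steps, divided
by L j.

For S in K this ratio can be made small uniformly. Zero entropy of S makes it small for long
itineraries under S^q, it is continuous in S at a fixed length, and subadditivity carries a bound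
from a length to its multiples. Compactness therefore yields one length L j that serves all of K and
the first j sets of the dense family, with bound 1 / (j + 1) (`exists_uniform_itinerary_length`).
Replacing an arbitrary set by a member of the family costs at most the binary entropy of their
symmetric difference per letter, so the ratio tends to zero for every measurable set
(`eventually_itinerary_entropy_le`). Conjugation only moves B (`partitionEntropy_itinerary_conj`),
so the same holds on the whole conjugacy saturation.

In contrast, for B of measure 1/2 every transformation can be perturbed at a cost of order 1/q,
however large L j is, so that the ratio becomes log 2 (`exists_independent_perturbation`). The model
is a skew product over a q-periodic clock acting on L independent copies of X: it applies s to each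
copy and rotates the copies once per period. Coordinate 0 follows s except at one clock value, yet
sampling it every q steps reads a fresh copy each time. Hence the transformations with ratio above
(log 2) / 2 for infinitely many j form a countable intersection of dense open sets, disjoint from
the saturation.

Non-genericity then follows from Baire's theorem, for which the Halmos metric is shown to be
complete (`completeSpace_halmos`). -/

theorem negMulLog_sum_le {ι : Type*} (s : Finset ι) (p : ι → ℝ) (hp : ∀ i ∈ s, 0 ≤ p i) :
    Real.negMulLog (∑ i ∈ s, p i) ≤ ∑ i ∈ s, Real.negMulLog (p i) := by
  have h : Real.negMulLog (∑ i ∈ s, p i) = ∑ i ∈ s, -(p i * Real.log (∑ k ∈ s, p k)) := by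
    rw [Real.negMulLog, Finset.sum_neg_distrib, ← Finset.sum_mul, neg_mul]
  rw [h]
  refine Finset.sum_le_sum fun i hi => ?_
  rw [Real.negMulLog, neg_mul, neg_le_neg_iff]
  rcases (hp i hi).eq_or_lt with h0 | h0
  · simp [← h0]
  · exact mul_le_mul_of_nonneg_left
      (Real.log_le_log h0 (Finset.single_le_sum hp hi)) h0.le

/-- A labelling with values in a finite set all of whose fibres are measurable. -/
def FiniteMeas {α : Type*} (ξ : X → α) : Prop := ∀ a, MeasurableSet (ξ ⁻¹' {a})

theorem FiniteMeas.prodMk {α β : Type*} {ξ : X → α} {η : X → β} (hξ : FiniteMeas ξ)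
    (hη : FiniteMeas η) : FiniteMeas fun x => (ξ x, η x) := by
  rintro ⟨a, b⟩
  convert (hξ a).inter (hη b) using 1
  ext x
  simp

theorem FiniteMeas.comp {α Y : Type*} [MeasurableSpace Y] {ξ : X → α} (hξ : FiniteMeas ξ)
    {f : Y → X} (hf : Measurable f) : FiniteMeas (ξ ∘ f) := fun a => hf (hξ a)

theorem FiniteMeas.pi {ι : Type*} [Finite ι] {α : Type*} {ξ : ι → X → α}
    (hξ : ∀ i, FiniteMeas (ξ i)) : FiniteMeas fun x i => ξ i x := by
  intro a
  have : (fun x i => ξ i x) ⁻¹' {a} = ⋂ i, ξ i ⁻¹' {a i} := by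
    ext x
    simp [funext_iff]
  rw [this]
  exact MeasurableSet.iInter fun i => hξ i (a i)

theorem measureReal_eq_sum_fiber {α : Type*} [Fintype α] (μ : Measure X) [IsFiniteMeasure μ]
    {ξ : X → α} (hξ : FiniteMeas ξ) (S : Set X) :
    μ.real S = ∑ a, μ.real (S ∩ ξ ⁻¹' {a}) := by
  have := measureReal_biUnion_finset (μ := μ.restrict S) (s := Finset.univ)
    (f := fun a => ξ ⁻¹' {a})
    (fun a _ b _ hab => Disjoint.preimage ξ (by simpa using hab)) (fun a _ => hξ a)
  have h2 : (⋃ a ∈ (Finset.univ : Finset α), ξ ⁻¹' {a}) = Set.univ := by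
    ext x; simp
  rw [h2] at this
  simp only [measureReal_restrict_apply (hξ _), measureReal_restrict_apply MeasurableSet.univ,
    Set.univ_inter] at this
  rw [this]
  simp only [Set.inter_comm]

/-- Coarsening merges fibres, so this is subadditivity of `Real.negMulLog` over each group of merged
fibres. -/
theorem partitionEntropy_comp_le {α β : Type*} [Fintype α] [Fintype β] (μ : Measure X)
    [IsFiniteMeasure μ] {ξ : X → α} (hξ : FiniteMeas ξ) (f : α → β) :
    partitionEntropy μ (f ∘ ξ) ≤ partitionEntropy μ ξ := by
  classical
  unfold partitionEntropy
  rw [← Finset.sum_fiberwise (s := Finset.univ) (g := f)]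
  refine Finset.sum_le_sum fun b _ => ?_
  have : μ.real ((f ∘ ξ) ⁻¹' {b}) = ∑ a with f a = b, μ.real (ξ ⁻¹' {a}) := by
    rw [measureReal_eq_sum_fiber μ hξ, Finset.sum_filter]
    refine Finset.sum_congr rfl fun a _ => ?_
    split_ifs with h
    · congr 1
      ext x
      simp only [Set.mem_inter_iff, Set.mem_preimage, Set.mem_singleton_iff, Function.comp]
      exact ⟨fun hx => hx.2, fun hx => ⟨by rw [hx, h], hx⟩⟩
    · have : (f ∘ ξ) ⁻¹' {b} ∩ ξ ⁻¹' {a} = ∅ := by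
        ext x
        simp only [Set.mem_inter_iff, Set.mem_preimage, Set.mem_singleton_iff, Function.comp,
          Set.mem_empty_iff_false, iff_false, not_and]
        rintro h1 rfl
        exact h h1
      simp [this]
  rw [this]
  exact negMulLog_sum_le _ _ fun _ _ => measureReal_nonneg

/-- This is log t ≤ t - 1 at t = ab/p. Summed over a joint distribution with its marginals it gives
subadditivity of entropy. -/
theorem negMulLog_le_of_product {p a b : ℝ} (hp : 0 ≤ p) (ha : p ≤ a) (hb : p ≤ b) :
    Real.negMulLog p ≤ -(p * Real.log a) - p * Real.log b + (a * b - p) := by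
  rcases hp.eq_or_lt with h0 | h0
  · subst h0
    simp
    positivity
  · have ha0 : 0 < a := h0.trans_le ha
    have hb0 : 0 < b := h0.trans_le hb
    have h := Real.log_le_sub_one_of_pos (x := a * b / p) (by positivity)
    rw [Real.log_div (by positivity) h0.ne', Real.log_mul ha0.ne' hb0.ne'] at h
    have h2 := mul_le_mul_of_nonneg_left h hp
    have h3 : p * (a * b / p - 1) = a * b - p := by field_simp
    rw [h3] at h2
    rw [Real.negMulLog]
    linarith

theorem partitionEntropy_prod_le {α β : Type*} [Fintype α] [Fintype β] (μ : Measure X)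
    [IsProbabilityMeasure μ] {ξ : X → α} {η : X → β} (hξ : FiniteMeas ξ) (hη : FiniteMeas η) :
    partitionEntropy μ (fun x => (ξ x, η x)) ≤ partitionEntropy μ ξ + partitionEntropy μ η := by
  set p : α → β → ℝ := fun a b => μ.real (ξ ⁻¹' {a} ∩ η ⁻¹' {b}) with hp
  set u : α → ℝ := fun a => μ.real (ξ ⁻¹' {a}) with hu
  set v : β → ℝ := fun b => μ.real (η ⁻¹' {b}) with hv
  have h1 : ∀ a, ∑ b, p a b = u a := fun a => (measureReal_eq_sum_fiber μ hη _).symm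
  have h2 : ∀ b, ∑ a, p a b = v b := fun b => by
    simp only [hp, hv, Set.inter_comm (ξ ⁻¹' _)]
    exact (measureReal_eq_sum_fiber μ hξ _).symm
  have hv1 : ∑ b, v b = 1 := by
    have := measureReal_eq_sum_fiber μ hη Set.univ
    simpa using this.symm
  have e0 : partitionEntropy μ (fun x => (ξ x, η x)) = ∑ a, ∑ b, Real.negMulLog (p a b) := by
    unfold partitionEntropy
    rw [Fintype.sum_prod_type]
    refine Finset.sum_congr rfl fun a _ => Finset.sum_congr rfl fun b _ => ?_
    congr 2
    ext x
    simp
  have e1 : partitionEntropy μ ξ = ∑ a, ∑ b, -(p a b * Real.log (u a)) := by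
    unfold partitionEntropy
    refine Finset.sum_congr rfl fun a _ => ?_
    rw [Finset.sum_neg_distrib, ← Finset.sum_mul, h1, Real.negMulLog, neg_mul]
  have e2 : partitionEntropy μ η = ∑ a, ∑ b, -(p a b * Real.log (v b)) := by
    unfold partitionEntropy
    rw [Finset.sum_comm]
    refine Finset.sum_congr rfl fun b _ => ?_
    rw [Finset.sum_neg_distrib, ← Finset.sum_mul, h2, Real.negMulLog, neg_mul]
  -- The joint and the product distribution have the same total mass, so the correction terms
  -- cancel.
  have e3 : ∑ a, ∑ b, (u a * v b - p a b) = 0 := by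
    simp only [Finset.sum_sub_distrib, ← Finset.mul_sum, hv1, h1, mul_one, sub_self,
      Finset.sum_const_zero]
  rw [e0, e1, e2, ← add_zero (_ + _), ← e3, ← Finset.sum_add_distrib, ← Finset.sum_add_distrib]
  refine Finset.sum_le_sum fun a _ => ?_
  rw [← Finset.sum_add_distrib, ← Finset.sum_add_distrib]
  refine Finset.sum_le_sum fun b _ => ?_
  have := negMulLog_le_of_product (p := p a b) (a := u a) (b := v b) measureReal_nonneg
    (measureReal_mono Set.inter_subset_left) (measureReal_mono Set.inter_subset_right)
  linarith

theorem partitionEntropy_comp_measurePreserving {α Y : Type*} [Fintype α] [MeasurableSpace Y]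
    {μ : Measure X} {ν : Measure Y} {ξ : X → α} (hξ : FiniteMeas ξ) {f : Y → X}
    (hf : MeasurePreserving f ν μ) : partitionEntropy ν (ξ ∘ f) = partitionEntropy μ ξ := by
  unfold partitionEntropy
  refine Finset.sum_congr rfl fun a _ => ?_
  rw [Set.preimage_comp, hf.measureReal_preimage (hξ a).nullMeasurableSet]

theorem partitionEntropy_congr {α : Type*} [Fintype α] {μ : Measure X} {ξ η : X → α}
    (h : ∀ᵐ x ∂μ, ξ x = η x) : partitionEntropy μ ξ = partitionEntropy μ η := by
  unfold partitionEntropy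
  refine Finset.sum_congr rfl fun a _ => ?_
  congr 1
  refine measureReal_congr ?_
  filter_upwards [h] with x hx
  change (ξ x = a) = (η x = a)
  rw [hx]

/-! ### Entropy of itineraries -/

theorem finiteMeas_itinerary {k : ℕ} {T : X → X} (hT : Measurable T) {ξ : X → Fin k}
    (hξ : FiniteMeas ξ) (n : ℕ) : FiniteMeas (itinerary T ξ n) :=
  FiniteMeas.pi fun i => hξ.comp (hT.iterate i)

/-- A word of length m + n is its first m letters together with the n letters read from T^[m] x;
invariance of μ makes the position of the second block irrelevant. -/
theorem partitionEntropy_itinerary_add_le {k : ℕ} {μ : Measure X} [IsProbabilityMeasure μ]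
    {T : X → X} (hT : MeasurePreserving T μ μ) {ξ : X → Fin k} (hξ : FiniteMeas ξ) (m n : ℕ) :
    partitionEntropy μ (itinerary T ξ (m + n)) ≤
      partitionEntropy μ (itinerary T ξ m) + partitionEntropy μ (itinerary T ξ n) := by
  have hm := finiteMeas_itinerary hT.measurable hξ m
  have hn := finiteMeas_itinerary hT.measurable hξ n
  have hn' := hn.comp (hT.iterate m).measurable
  have h := partitionEntropy_prod_le μ hm hn'
  rw [partitionEntropy_comp_measurePreserving hn (hT.iterate m)] at h
  refine le_trans ?_ h
  have e : itinerary T ξ (m + n) = (fun p : (Fin m → Fin k) × (Fin n → Fin k) =>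
      Fin.append p.1 p.2) ∘ fun x => (itinerary T ξ m x, (itinerary T ξ n ∘ T^[m]) x) := by
    funext x i
    refine Fin.addCases (fun i => ?_) (fun i => ?_) i
    · simp [itinerary]
    · simp [itinerary, ← Function.iterate_add_apply, add_comm]
  rw [e]
  exact partitionEntropy_comp_le μ (hm.prodMk hn') _

theorem partitionEntropy_itinerary_zero {k : ℕ} {μ : Measure X} [IsProbabilityMeasure μ]
    (T : X → X) (ξ : X → Fin k) : partitionEntropy μ (itinerary T ξ 0) = 0 := by
  unfold partitionEntropy
  refine Finset.sum_eq_zero fun a _ => ?_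
  have : itinerary T ξ 0 ⁻¹' {a} = Set.univ := by
    ext x
    simp [Subsingleton.elim (itinerary T ξ 0 x) a]
  simp [this]

theorem partitionEntropy_itinerary_mul_le {k : ℕ} {μ : Measure X} [IsProbabilityMeasure μ]
    {T : X → X} (hT : MeasurePreserving T μ μ) {ξ : X → Fin k} (hξ : FiniteMeas ξ) (m n : ℕ) :
    partitionEntropy μ (itinerary T ξ (m * n)) ≤ m * partitionEntropy μ (itinerary T ξ n) := by
  induction m with
  | zero =>
    rw [zero_mul, partitionEntropy_itinerary_zero]
    simp
  | succ m ih =>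
    rw [Nat.succ_mul]
    have := partitionEntropy_itinerary_add_le hT hξ (m * n) n
    push_cast
    linarith

theorem partitionEntropy_itinerary_le {k : ℕ} {μ : Measure X} [IsProbabilityMeasure μ]
    {T : X → X} (hT : MeasurePreserving T μ μ) {ξ : X → Fin k} (hξ : FiniteMeas ξ) (n : ℕ) :
    partitionEntropy μ (itinerary T ξ n) ≤ n * partitionEntropy μ ξ := by
  have h := partitionEntropy_itinerary_mul_le hT hξ n 1
  rw [mul_one] at h
  refine h.trans (mul_le_mul_of_nonneg_left ?_ (Nat.cast_nonneg n))
  have e : itinerary T ξ 1 = (fun a _ => a) ∘ ξ := by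
    funext x i
    simp [itinerary]
  rw [e]
  exact partitionEntropy_comp_le μ hξ _

/-- The letters at multiples of j form a coarsening of the full itinerary of length j * n. -/
theorem partitionEntropy_itinerary_iterate_le {k : ℕ} {μ : Measure X} [IsProbabilityMeasure μ]
    {T : X → X} (hT : Measurable T) {ξ : X → Fin k} (hξ : FiniteMeas ξ) {j : ℕ} (hj : 0 < j)
    (n : ℕ) :
    partitionEntropy μ (itinerary T^[j] ξ n) ≤ partitionEntropy μ (itinerary T ξ (j * n)) := by
  have e : itinerary T^[j] ξ n = (fun a (i : Fin n) =>
      a (⟨j * i, Nat.mul_lt_mul_of_pos_left i.2 hj⟩ : Fin (j * n))) ∘ itinerary T ξ (j * n) := by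
    funext x i
    simp [itinerary, Function.iterate_mul]
  rw [e]
  exact partitionEntropy_comp_le μ (finiteMeas_itinerary hT hξ _) _

/-- If `ξ` is a function of `η` and `ζ`, then the entropy of an itinerary of `ξ` exceeds that of
`η` by at most `n H(ζ)`. -/
theorem partitionEntropy_itinerary_le_add {k l m : ℕ} {μ : Measure X} [IsProbabilityMeasure μ]
    {T : X → X} (hT : MeasurePreserving T μ μ) {η : X → Fin l} {ζ : X → Fin m}
    (hη : FiniteMeas η) (hζ : FiniteMeas ζ) {ξ : X → Fin k} (f : Fin l → Fin m → Fin k)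
    (hf : ∀ x, ξ x = f (η x) (ζ x)) (n : ℕ) :
    partitionEntropy μ (itinerary T ξ n) ≤
      partitionEntropy μ (itinerary T η n) + n * partitionEntropy μ ζ := by
  have h1 := finiteMeas_itinerary hT.measurable hη n
  have h2 := finiteMeas_itinerary hT.measurable hζ n
  have h3 := partitionEntropy_prod_le μ h1 h2
  have h4 := partitionEntropy_itinerary_le hT hζ n
  have e : itinerary T ξ n = (fun p : (Fin n → Fin l) × (Fin n → Fin m) =>
      fun i => f (p.1 i) (p.2 i)) ∘ fun x => (itinerary T η n x, itinerary T ζ n x) := by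
    funext x i
    simp [itinerary, hf]
  rw [e]
  linarith [partitionEntropy_comp_le μ (h1.prodMk h2)
    (fun p : (Fin n → Fin l) × (Fin n → Fin m) => fun i => f (p.1 i) (p.2 i))]

/-! ### Two-set partitions -/

open Classical in
/-- The labelling of the partition `{B, Bᶜ}`. -/
def twoSet {Y : Type*} (B : Set Y) (x : Y) : Fin 2 := if x ∈ B then 1 else 0

theorem twoSet_preimage_one {Y : Type*} (B : Set Y) : twoSet B ⁻¹' {1} = B := by
  ext x
  by_cases h : x ∈ B <;> simp [twoSet, h]

theorem twoSet_preimage_zero {Y : Type*} (B : Set Y) : twoSet B ⁻¹' {0} = Bᶜ := by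
  ext x
  by_cases h : x ∈ B <;> simp [twoSet, h]

theorem finiteMeas_twoSet {B : Set X} (hB : MeasurableSet B) : FiniteMeas (twoSet B) := by
  intro a
  fin_cases a
  · exact (twoSet_preimage_zero B).symm ▸ hB.compl
  · change MeasurableSet (twoSet B ⁻¹' {1})
    rwa [twoSet_preimage_one B]

theorem measurable_twoSet {B : Set X} (hB : MeasurableSet B) : Measurable (twoSet B) :=
  measurable_to_countable' (finiteMeas_twoSet hB)

theorem partitionEntropy_twoSet {μ : Measure X} [IsProbabilityMeasure μ] {B : Set X}
    (hB : MeasurableSet B) : partitionEntropy μ (twoSet B) = Real.binEntropy (μ.real B) := by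
  unfold partitionEntropy
  rw [Fin.sum_univ_two, twoSet_preimage_zero, twoSet_preimage_one, probReal_compl_eq_one_sub hB,
    Real.binEntropy_eq_negMulLog_add_negMulLog_one_sub, add_comm]

/-- Addition in `Fin 2` is exclusive or. This is the recovery function that
`partitionEntropy_itinerary_le_add` needs to exchange one set for a nearby one. -/
theorem twoSet_eq_add_symmDiff {Y : Type*} (B C : Set Y) (x : Y) :
    twoSet B x = twoSet C x + twoSet (symmDiff B C) x := by
  by_cases h1 : x ∈ B <;> by_cases h2 : x ∈ C <;> simp [twoSet, h1, h2, Set.mem_symmDiff]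

/-! ### Isomorphism of non-atomic measures on standard Borel spaces -/

section Iso

open Set

/-- Two measures are isomorphic if there are measure-preserving maps in both directions that are
almost everywhere inverse to each other. -/
def MeasureIso {X Y : Type*} [MeasurableSpace X] [MeasurableSpace Y] (μ : Measure X)
    (ν : Measure Y) : Prop :=
  ∃ (φ : X → Y) (ψ : Y → X), MeasurePreserving φ μ ν ∧ MeasurePreserving ψ ν μ ∧
    (∀ᵐ x ∂μ, ψ (φ x) = x) ∧ ∀ᵐ y ∂ν, φ (ψ y) = y

theorem MeasureIso.symm {X Y : Type*} [MeasurableSpace X] [MeasurableSpace Y] {μ : Measure X}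
    {ν : Measure Y} (h : MeasureIso μ ν) : MeasureIso ν μ := by
  obtain ⟨φ, ψ, h1, h2, h3, h4⟩ := h
  exact ⟨ψ, φ, h2, h1, h4, h3⟩

theorem MeasureIso.trans {X Y Z : Type*} [MeasurableSpace X] [MeasurableSpace Y]
    [MeasurableSpace Z] {μ : Measure X} {ν : Measure Y} {ρ : Measure Z} (h : MeasureIso μ ν)
    (h' : MeasureIso ν ρ) : MeasureIso μ ρ := by
  obtain ⟨φ, ψ, h1, h2, h3, h4⟩ := h
  obtain ⟨φ', ψ', h1', h2', h3', h4'⟩ := h'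
  refine ⟨φ' ∘ φ, ψ ∘ ψ', h1'.comp h1, h2.comp h2', ?_, ?_⟩
  · filter_upwards [h3, h1.quasiMeasurePreserving.ae h3'] with x hx hx'
    simp only [Function.comp, hx', hx]
  · filter_upwards [h4', h2'.quasiMeasurePreserving.ae h4] with x hx hx'
    simp only [Function.comp, hx', hx]

theorem measureIso_map_embedding {X Y : Type*} [MeasurableSpace X] [MeasurableSpace Y] [Nonempty X]
    (μ : Measure X) {e : X → Y} (he : MeasurableEmbedding e) : MeasureIso μ (μ.map e) := by
  obtain ⟨g, hg, hge⟩ := he.exists_measurable_extend measurable_id (fun _ => inferInstance)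
  have hge' : ∀ x, g (e x) = x := fun x => congrFun hge x
  refine ⟨e, g, ⟨he.measurable, rfl⟩, ⟨hg, ?_⟩, Eventually.of_forall hge', ?_⟩
  · rw [Measure.map_map hg he.measurable, hge, Measure.map_id]
  · rw [he.ae_map_iff]
    exact Eventually.of_forall fun x => by rw [hge']

/-! ### Distribution functions and monotone rearrangement on the line. -/

theorem continuous_measureReal_Iic (α : Measure ℝ) [IsFiniteMeasure α] [NullSingletonClass α] :
    Continuous fun t => α.real (Iic t) := by
  have h := intervalIntegral.continuous_primitive (μ := α) (f := fun _ => (1 : ℝ))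
    (fun a b => (integrable_const (1 : ℝ)).intervalIntegrable) 0
  have e : (fun t => α.real (Iic t)) = fun t => (∫ _ in (0 : ℝ)..t, (1 : ℝ) ∂α) + α.real (Iic 0) := by
    funext t
    rw [← intervalIntegral.integral_Iic_sub_Iic (integrable_const (1 : ℝ)).integrableOn
      (integrable_const (1 : ℝ)).integrableOn]
    simp
  rw [e]
  exact h.add continuous_const

theorem monotone_measureReal_Iic (α : Measure ℝ) [IsFiniteMeasure α] :
    Monotone fun t => α.real (Iic t) :=
  fun _ _ h => measureReal_mono (Iic_subset_Iic.2 h)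

theorem exists_measureReal_Iic_gt (α : Measure ℝ) [IsFiniteMeasure α] {u : ℝ}
    (hu : u < α.real univ) : ∃ t, u < α.real (Iic t) := by
  have h := (ENNReal.tendsto_toReal (measure_ne_top α univ)).comp (tendsto_measure_Iic_atTop α)
  exact (h.eventually_const_lt hu).exists

theorem exists_measureReal_Iic_lt (α : Measure ℝ) [IsFiniteMeasure α] [NullSingletonClass α]
    {u : ℝ} (hu : 0 < u) : ∃ t, α.real (Iic t) < u := by
  have h := (ENNReal.tendsto_toReal (measure_ne_top α univ)).comp (tendsto_measure_Ici_atBot α)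
  obtain ⟨t, ht⟩ := (h.eventually_const_lt (v := α.real univ) (u := α.real univ - u)
    (by linarith)).exists
  refine ⟨t, ?_⟩
  have h1 : α.real (Ioi t) = α.real (Ici t) := measureReal_congr Ioi_ae_eq_Ici
  have h2 := measureReal_add_measureReal_compl (μ := α) (measurableSet_Iic (a := t))
  rw [compl_Iic, h1] at h2
  have h3 : α.real univ - u < α.real (Ici t) := ht
  linarith

/-- The sublevel set is closed, non-empty and bounded above, so it is the half-line ending at its
supremum; the intermediate value theorem shows that the value there is exactly u. -/
theorem exists_measureReal_Iic_le_eq (α : Measure ℝ) [IsFiniteMeasure α] [NullSingletonClass α]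
    {u : ℝ} (h0 : 0 < u) (hu : u < α.real univ) :
    ∃ s, α.real (Iic s) = u ∧ {x | α.real (Iic x) ≤ u} = Iic s := by
  have hc := continuous_measureReal_Iic α
  have hm := monotone_measureReal_Iic α
  obtain ⟨a, ha⟩ := exists_measureReal_Iic_lt α h0
  obtain ⟨b, hb⟩ := exists_measureReal_Iic_gt α hu
  have hne : {x | α.real (Iic x) ≤ u}.Nonempty := ⟨a, ha.le⟩
  have hbd : BddAbove {x | α.real (Iic x) ≤ u} :=
    ⟨b, fun x hx => le_of_lt (hm.reflect_lt (lt_of_le_of_lt hx hb))⟩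
  have hcl : IsClosed {x | α.real (Iic x) ≤ u} := isClosed_le hc continuous_const
  have hmem := hcl.csSup_mem hne hbd
  obtain ⟨c, hcu⟩ : ∃ c, α.real (Iic c) = u := by
    have := mem_range_of_exists_le_of_exists_ge hc ⟨a, ha.le⟩ ⟨b, hb.le⟩
    exact this
  refine ⟨sSup {x | α.real (Iic x) ≤ u}, le_antisymm hmem ?_, ?_⟩
  · rw [← hcu]
    exact hm (le_csSup hbd (le_of_eq hcu) |>.trans_eq (by rw [hcu]))
  · ext x
    exact ⟨fun hx => le_csSup hbd hx, fun hx => (hm hx).trans hmem⟩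

theorem measureReal_measureReal_Iic_le (α : Measure ℝ) [IsFiniteMeasure α] [NullSingletonClass α]
    {u : ℝ} (h0 : 0 < u) (hu : u < α.real univ) : α.real {x | α.real (Iic x) ≤ u} = u := by
  obtain ⟨s, h1, h2⟩ := exists_measureReal_Iic_le_eq α h0 hu
  rw [h2, h1]

/-- An exceptional set of mass v > 0 would lie in the sublevel set at v / 2, whose mass is only v /
2. -/
theorem ae_measureReal_Iic_pos (α : Measure ℝ) [IsFiniteMeasure α] [NullSingletonClass α] :
    ∀ᵐ x ∂α, 0 < α.real (Iic x) := by
  rw [ae_iff, ← measureReal_eq_zero_iff]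
  by_contra hne
  have hpos : 0 < α.real {x | ¬ 0 < α.real (Iic x)} := lt_of_le_of_ne measureReal_nonneg (Ne.symm hne)
  set v := α.real {x | ¬ 0 < α.real (Iic x)} with hv
  have hvm : v ≤ α.real univ := measureReal_mono (subset_univ _)
  have h := measureReal_measureReal_Iic_le α (u := v / 2) (by linarith) (by linarith)
  have h2 : v ≤ α.real {x | α.real (Iic x) ≤ v / 2} :=
    measureReal_mono fun x hx => (not_lt.1 hx).trans (by linarith)
  linarith

theorem ae_measureReal_Iic_lt (α : Measure ℝ) [IsFiniteMeasure α] [NullSingletonClass α] :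
    ∀ᵐ x ∂α, α.real (Iic x) < α.real univ := by
  rw [ae_iff, ← measureReal_eq_zero_iff]
  by_contra hne
  have hpos : 0 < α.real {x | ¬ α.real (Iic x) < α.real univ} :=
    lt_of_le_of_ne measureReal_nonneg (Ne.symm hne)
  set v := α.real {x | ¬ α.real (Iic x) < α.real univ} with hv
  have hvm : v ≤ α.real univ := measureReal_mono (subset_univ _)
  have h := measureReal_measureReal_Iic_le α (u := α.real univ - v / 2) (by linarith) (by linarith)
  have hms : MeasurableSet {x | α.real (Iic x) ≤ α.real univ - v / 2} :=
    measurableSet_le (monotone_measureReal_Iic α).measurable measurable_const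
  have h3 := measureReal_add_measureReal_compl (μ := α) hms
  have h2 : v ≤ α.real {x | α.real (Iic x) ≤ α.real univ - v / 2}ᶜ := by
    refine measureReal_mono fun x hx => ?_
    have hx' : α.real univ ≤ α.real (Iic x) := not_lt.1 hx
    simp only [mem_compl_iff, mem_ofPred_eq, not_le]
    linarith
  linarith

/-- The monotone rearrangement of `α` onto `β`. -/
def rearrange (α β : Measure ℝ) (x : ℝ) : ℝ := sInf {t | α.real (Iic x) ≤ β.real (Iic t)}

theorem isLeast_rearrange (α β : Measure ℝ) [IsFiniteMeasure β]
    [NullSingletonClass β] {x : ℝ} (h0 : 0 < α.real (Iic x)) (h1 : α.real (Iic x) < β.real univ) :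
    IsLeast {t | α.real (Iic x) ≤ β.real (Iic t)} (rearrange α β x) := by
  have hm := monotone_measureReal_Iic β
  obtain ⟨a, ha⟩ := exists_measureReal_Iic_lt β h0
  obtain ⟨b, hb⟩ := exists_measureReal_Iic_gt β h1
  have hbd : BddBelow {t | α.real (Iic x) ≤ β.real (Iic t)} :=
    ⟨a, fun t ht => le_of_lt (hm.reflect_lt (ha.trans_le ht))⟩
  have hcl : IsClosed {t | α.real (Iic x) ≤ β.real (Iic t)} :=
    isClosed_le continuous_const (continuous_measureReal_Iic β)
  exact ⟨hcl.csInf_mem ⟨b, hb.le⟩ hbd, fun t ht => csInf_le hbd ht⟩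

theorem rearrange_le_iff (α β : Measure ℝ) [IsFiniteMeasure β]
    [NullSingletonClass β] {x : ℝ} (h0 : 0 < α.real (Iic x)) (h1 : α.real (Iic x) < β.real univ)
    (t : ℝ) : rearrange α β x ≤ t ↔ α.real (Iic x) ≤ β.real (Iic t) :=
  ⟨fun h => (isLeast_rearrange α β h0 h1).1.trans (monotone_measureReal_Iic β h),
    fun h => (isLeast_rearrange α β h0 h1).2 h⟩

theorem measureReal_Iic_rearrange (α β : Measure ℝ) [IsFiniteMeasure β]
    [NullSingletonClass β] {x : ℝ} (h0 : 0 < α.real (Iic x)) (h1 : α.real (Iic x) < β.real univ) :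
    β.real (Iic (rearrange α β x)) = α.real (Iic x) := by
  obtain ⟨s, hs, -⟩ := exists_measureReal_Iic_le_eq β h0 h1
  refine le_antisymm ?_ (isLeast_rearrange α β h0 h1).1
  rw [← hs]
  exact monotone_measureReal_Iic β ((rearrange_le_iff α β h0 h1 s).2 hs.ge)

theorem exists_measurable_ae_eq_rearrange (α β : Measure ℝ) [IsFiniteMeasure α]
    [IsFiniteMeasure β] [NullSingletonClass α] [NullSingletonClass β]
    (h : α univ = β univ) :
    ∃ φ : ℝ → ℝ, MeasurePreserving φ α β ∧ ∀ᵐ x ∂α, φ x = rearrange α β x := by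
  classical
  have hreal : α.real univ = β.real univ := by simp only [measureReal_def, h]
  set D : Set ℝ := {x | 0 < α.real (Iic x)} ∩ {x | α.real (Iic x) < α.real univ} with hD
  have hFm : Measurable fun x => α.real (Iic x) := (monotone_measureReal_Iic α).measurable
  have hDm : MeasurableSet D :=
    (measurableSet_lt measurable_const hFm).inter (measurableSet_lt hFm measurable_const)
  have hDae : ∀ᵐ x ∂α, x ∈ D := by
    filter_upwards [ae_measureReal_Iic_pos α, ae_measureReal_Iic_lt α] with x h1 h2
    exact ⟨h1, h2⟩
  -- Off the conull set D the infimum may be over an empty or unbounded set, so an arbitrary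
  -- constant replaces it.
  set φ : ℝ → ℝ := fun x => if x ∈ D then rearrange α β x else 0 with hφ
  have hle : ∀ x ∈ D, ∀ t, (φ x ≤ t ↔ α.real (Iic x) ≤ β.real (Iic t)) := by
    intro x hx t
    simp only [hφ, hx, if_true]
    exact rearrange_le_iff α β hx.1 (hreal ▸ hx.2) t
  have hφm : Measurable φ := by
    refine measurable_of_Iic fun t => ?_
    have e : φ ⁻¹' Iic t = (D ∩ {x | α.real (Iic x) ≤ β.real (Iic t)}) ∪
        (Dᶜ ∩ {_x | (0 : ℝ) ≤ t}) := by
      ext x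
      by_cases hx : x ∈ D
      · simp [hx, hle x hx t]
      · simp [hx, hφ]
    rw [e]
    exact (hDm.inter (measurableSet_le hFm measurable_const)).union
      (hDm.compl.inter (MeasurableSet.const _))
  refine ⟨φ, ⟨hφm, ?_⟩, ?_⟩
  · refine Measure.ext_of_Iic _ _ fun t => ?_
    rw [Measure.map_apply hφm measurableSet_Iic]
    have e : α (φ ⁻¹' Iic t) = α {x | α.real (Iic x) ≤ β.real (Iic t)} := by
      refine measure_congr ?_
      filter_upwards [hDae] with x hx
      exact propext (hle x hx t)
    rw [e]
    have e' : α.real {x | α.real (Iic x) ≤ β.real (Iic t)} = β.real (Iic t) := by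
      rcases (measureReal_nonneg (μ := β) (s := Iic t)).eq_or_lt with h0 | h0
      · rw [← h0, measureReal_eq_zero_iff]
        refine measure_mono_null ?_ (ae_iff.1 (ae_measureReal_Iic_pos α))
        intro x hx
        exact not_lt.2 hx
      · rcases (measureReal_mono (μ := β) (subset_univ (Iic t))).eq_or_lt with h1 | h1
        · rw [h1, ← hreal]
          congr 1
          ext x
          simp only [mem_ofPred_eq, mem_univ, iff_true]
          exact measureReal_mono (subset_univ _)
        · exact measureReal_measureReal_Iic_le α h0 (hreal ▸ h1)
    exact (measureReal_eq_measureReal_iff (measure_ne_top _ _) (measure_ne_top _ _)).1 e'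
  · filter_upwards [hDae] with x hx
    simp [hφ, hx]

/-- Each rational half-line is contained in its preimage up to a null set and has the same finite
measure, so the two agree almost everywhere. A rational strictly between f x and x would contradict
this. -/
theorem ae_eq_id_of_le_of_measurePreserving {α : Measure ℝ} [IsFiniteMeasure α] {f : ℝ → ℝ}
    (hf : MeasurePreserving f α α) (hle : ∀ᵐ x ∂α, f x ≤ x) : ∀ᵐ x ∂α, f x = x := by
  have h : ∀ r : ℚ, ∀ᵐ x ∂α, f x ≤ r → x ≤ r := by
    intro r
    have h1 : (Iic (r : ℝ) : Set ℝ) ≤ᵐ[α] f ⁻¹' Iic (r : ℝ) := by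
      filter_upwards [hle] with x hx hx'
      exact hx.trans hx'
    have h2 := ae_eq_of_ae_subset_of_measure_ge h1
      (hf.measure_preimage measurableSet_Iic.nullMeasurableSet).le
      measurableSet_Iic.nullMeasurableSet (measure_ne_top _ _)
    filter_upwards [h2] with x hx hx'
    have : (x ∈ Iic (r : ℝ)) = (x ∈ f ⁻¹' Iic (r : ℝ)) := hx
    exact this.mpr hx'
  filter_upwards [hle, ae_all_iff.2 h] with x hx hr
  refine le_antisymm hx (not_lt.1 fun hlt => ?_)
  obtain ⟨r, h1, h2⟩ := exists_rat_btwn hlt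
  exact absurd (hr r h1.le) (not_le.2 h2)

/-- Rearranging preserves the value of the distribution function, so x competes in the infimum that
defines the way back. Only this inequality is needed, since `ae_eq_id_of_le_of_measurePreserving`
upgrades it to equality. -/
theorem ae_rearrange_rearrange_le (α β : Measure ℝ) [IsFiniteMeasure α] [IsFiniteMeasure β]
    [NullSingletonClass α] [NullSingletonClass β] (h : α univ = β univ) :
    ∀ᵐ x ∂α, rearrange β α (rearrange α β x) ≤ x := by
  have hreal : α.real univ = β.real univ := by simp only [measureReal_def, h]
  filter_upwards [ae_measureReal_Iic_pos α, ae_measureReal_Iic_lt α] with x h0 h1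
  have e := measureReal_Iic_rearrange α β h0 (hreal ▸ h1)
  rw [rearrange_le_iff β α (by rw [e]; exact h0) (by rw [e]; exact h1), e]

theorem measureIso_real (α β : Measure ℝ) [IsFiniteMeasure α] [IsFiniteMeasure β]
    [NullSingletonClass α] [NullSingletonClass β] (h : α univ = β univ) : MeasureIso α β := by
  obtain ⟨φ, hφ, hφe⟩ := exists_measurable_ae_eq_rearrange α β h
  obtain ⟨ψ, hψ, hψe⟩ := exists_measurable_ae_eq_rearrange β α h.symm
  refine ⟨φ, ψ, hφ, hψ, ?_, ?_⟩
  · refine ae_eq_id_of_le_of_measurePreserving (hψ.comp hφ) ?_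
    filter_upwards [hφe, hφ.quasiMeasurePreserving.ae hψe, ae_rearrange_rearrange_le α β h]
      with x h1 h2 h3
    rw [h2, h1]
    exact h3
  · refine ae_eq_id_of_le_of_measurePreserving (hφ.comp hψ) ?_
    filter_upwards [hψe, hψ.quasiMeasurePreserving.ae hφe, ae_rearrange_rearrange_le β α h.symm]
      with x h1 h2 h3
    rw [h2, h1]
    exact h3

theorem nullSingletonClass_map_embedding {X Y : Type*} [MeasurableSpace X] [MeasurableSpace Y]
    (μ : Measure X) [NullSingletonClass μ] {e : X → Y} (he : MeasurableEmbedding e) :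
    NullSingletonClass (μ.map e) where
  measure_singleton y := by
    rw [he.map_apply]
    exact (subsingleton_singleton.preimage he.injective).measure_zero μ

/-- Non-atomic finite measures of equal mass on standard Borel spaces are isomorphic. -/
theorem measureIso_of_measure_univ_eq {X Y : Type*} [MeasurableSpace X] [MeasurableSpace Y]
    [StandardBorelSpace X] [StandardBorelSpace Y] [Nonempty X] [Nonempty Y]
    (μ : Measure X) (ν : Measure Y) [IsFiniteMeasure μ] [IsFiniteMeasure ν]
    [NullSingletonClass μ] [NullSingletonClass ν] (h : μ univ = ν univ) : MeasureIso μ ν := by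
  have hX := measurableEmbedding_embeddingReal X
  have hY := measurableEmbedding_embeddingReal Y
  have := nullSingletonClass_map_embedding μ hX
  have := nullSingletonClass_map_embedding ν hY
  refine (measureIso_map_embedding μ hX).trans (MeasureIso.trans (measureIso_real _ _ ?_)
    (measureIso_map_embedding ν hY).symm)
  rw [Measure.map_apply hX.measurable MeasurableSet.univ,
    Measure.map_apply hY.measurable MeasurableSet.univ]
  exact h

/-- The second conclusion keeps track of the fibre a point lands in, which lets
`exists_measureIso_label` invert glued maps fibre by fibre. -/
theorem exists_gluing {X Y ι : Type*} [MeasurableSpace X] [MeasurableSpace Y] [Finite ι]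
    {μ : Measure X} {ν : Measure Y} [IsFiniteMeasure μ] [IsFiniteMeasure ν]
    {P : X → ι} {Q : Y → ι} (hP : FiniteMeas P) (hQ : FiniteMeas Q) {φ : ι → X → Y}
    (hφ : ∀ a, MeasurePreserving (φ a) (μ.restrict (P ⁻¹' {a})) (ν.restrict (Q ⁻¹' {a}))) :
    MeasurePreserving (fun x => φ (P x) x) μ ν ∧ ∀ᵐ x ∂μ, Q (φ (P x) x) = P x := by
  classical
  cases nonempty_fintype ι
  have hpre : ∀ S, (fun x => φ (P x) x) ⁻¹' S = ⋃ a, P ⁻¹' {a} ∩ φ a ⁻¹' S := by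
    intro S
    ext x
    simp
  have hm : Measurable fun x => φ (P x) x := by
    intro S hS
    rw [hpre]
    exact MeasurableSet.iUnion fun a => (hP a).inter ((hφ a).measurable hS)
  refine ⟨⟨hm, ?_⟩, ?_⟩
  · ext S hS
    rw [Measure.map_apply hm hS, ← ENNReal.toReal_eq_toReal_iff' (measure_ne_top _ _)
      (measure_ne_top _ _)]
    change μ.real _ = ν.real _
    rw [measureReal_eq_sum_fiber μ hP, measureReal_eq_sum_fiber ν hQ]
    refine Finset.sum_congr rfl fun a _ => ?_
    rw [← measureReal_restrict_apply hS, ← (hφ a).measureReal_preimage hS.nullMeasurableSet,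
      measureReal_restrict_apply ((hφ a).measurable hS)]
    congr 1
    ext x
    simp only [mem_inter_iff, mem_preimage, mem_singleton_iff]
    constructor
    · rintro ⟨h1, rfl⟩
      exact ⟨h1, rfl⟩
    · rintro ⟨h1, rfl⟩
      exact ⟨h1, rfl⟩
  · have h : ∀ a, ∀ᵐ x ∂μ, P x = a → Q (φ a x) = a := by
      intro a
      have h1 : ∀ᵐ y ∂ν.restrict (Q ⁻¹' {a}), Q y = a := ae_restrict_mem (hQ a)
      have h2 := (hφ a).quasiMeasurePreserving.ae h1
      exact (ae_restrict_iff' (hP a)).1 h2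
    filter_upwards [ae_all_iff.2 h] with x hx
    exact hx _ rfl

/-- An isomorphism of non-atomic probability measures can be chosen to respect finite labellings
with the same distribution. -/
theorem exists_measureIso_label {X Y ι : Type*} [MeasurableSpace X] [MeasurableSpace Y]
    [StandardBorelSpace X] [StandardBorelSpace Y] [Nonempty X] [Nonempty Y] [Finite ι]
    (μ : Measure X) (ν : Measure Y) [IsFiniteMeasure μ] [IsFiniteMeasure ν]
    [NullSingletonClass μ] [NullSingletonClass ν] {P : X → ι} {Q : Y → ι} (hP : FiniteMeas P)
    (hQ : FiniteMeas Q) (h : ∀ a, μ (P ⁻¹' {a}) = ν (Q ⁻¹' {a})) :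
    ∃ (φ : X → Y) (ψ : Y → X), MeasurePreserving φ μ ν ∧ MeasurePreserving ψ ν μ ∧
      (∀ᵐ x ∂μ, ψ (φ x) = x) ∧ (∀ᵐ y ∂ν, φ (ψ y) = y) ∧ ∀ᵐ x ∂μ, Q (φ x) = P x := by
  have hiso : ∀ a, MeasureIso (μ.restrict (P ⁻¹' {a})) (ν.restrict (Q ⁻¹' {a})) := by
    intro a
    refine measureIso_of_measure_univ_eq _ _ ?_
    rw [Measure.restrict_apply_univ, Measure.restrict_apply_univ, h]
  choose φ ψ h1 h2 h3 h4 using hiso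
  obtain ⟨g1, g2⟩ := exists_gluing hP hQ h1
  obtain ⟨g3, g4⟩ := exists_gluing hQ hP h2
  refine ⟨_, _, g1, g3, ?_, ?_, g2⟩
  · have h : ∀ a, ∀ᵐ x ∂μ, P x = a → ψ a (φ a x) = x := fun a =>
      (ae_restrict_iff' (hP a)).1 (h3 a)
    filter_upwards [g2, ae_all_iff.2 h] with x hx hx'
    rw [hx]
    exact hx' _ rfl
  · have h : ∀ a, ∀ᵐ x ∂ν, Q x = a → φ a (ψ a x) = x := fun a =>
      (ae_restrict_iff' (hQ a)).1 (h4 a)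
    filter_upwards [g4, ae_all_iff.2 h] with x hx hx'
    rw [hx]
    exact hx' _ rfl

/-- A non-atomic probability space has a set of measure `1 / 2`. -/
theorem exists_measureReal_eq_half {X : Type*} [MeasurableSpace X] [StandardBorelSpace X]
    (μ : Measure X) [IsProbabilityMeasure μ] [NullSingletonClass μ] :
    ∃ B, MeasurableSet B ∧ μ.real B = 1 / 2 := by
  have he := measurableEmbedding_embeddingReal X
  have := nullSingletonClass_map_embedding μ he
  have hu : (μ.map (embeddingReal X)).real univ = 1 := by
    rw [map_measureReal_apply he.measurable MeasurableSet.univ]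
    simp
  obtain ⟨s, hs, -⟩ := exists_measureReal_Iic_le_eq (μ.map (embeddingReal X)) (u := 1 / 2)
    (by norm_num) (by rw [hu]; norm_num)
  rw [map_measureReal_apply he.measurable measurableSet_Iic] at hs
  exact ⟨_, he.measurable measurableSet_Iic, hs⟩

end Iso

/-! ### Pointwise realization of almost everywhere inverse maps -/

/-- The maps are true inverses on the conull set of points whose images under all words in s and t
avoid the bad null set; this set is stable under both maps, and the identity is used off it. -/
theorem exists_mpGroup_ae_eq {μ : Measure X} {s t : X → X} (hs : MeasurePreserving s μ μ)
    (ht : MeasurePreserving t μ μ) (hst : ∀ᵐ x ∂μ, s (t x) = x) (hts : ∀ᵐ x ∂μ, t (s x) = x) :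
    ∃ e : MPGroup μ, (∀ᵐ x ∂μ, e.1 x = s x) ∧ ∀ᵐ x ∂μ, e.1.symm x = t x := by
  classical
  obtain ⟨G, hGsub, hGm, hG0⟩ := exists_measurable_superset_of_null (ae_iff.1 (hst.and hts))
  -- The head of the word acts first, so prepending a letter shows that Z is mapped into itself by s
  -- and by t.
  set act : List Bool → X → X := fun w x => w.foldl (fun y b => if b then s y else t y) x with hact
  have hact_mp : ∀ w, MeasurePreserving (act w) μ μ := by
    intro w
    induction w with
    | nil => exact MeasurePreserving.id μ
    | cons b w ih =>
      cases b
      · exact ih.comp ht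
      · exact ih.comp hs
  set Z : Set X := ⋂ w, act w ⁻¹' Gᶜ with hZ
  have hZm : MeasurableSet Z := MeasurableSet.iInter fun w => (hact_mp w).measurable hGm.compl
  have hZae : ∀ᵐ x ∂μ, x ∈ Z := by
    have : ∀ w, ∀ᵐ x ∂μ, act w x ∈ Gᶜ := fun w =>
      (hact_mp w).quasiMeasurePreserving.ae (measure_eq_zero_iff_ae_notMem.1 hG0)
    filter_upwards [ae_all_iff.2 this] with x hx
    exact Set.mem_iInter.2 hx
  have hZs : ∀ x ∈ Z, s x ∈ Z := fun x hx =>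
    Set.mem_iInter.2 fun w => Set.mem_iInter.1 hx (true :: w)
  have hZt : ∀ x ∈ Z, t x ∈ Z := fun x hx =>
    Set.mem_iInter.2 fun w => Set.mem_iInter.1 hx (false :: w)
  have hZinv : ∀ x ∈ Z, s (t x) = x ∧ t (s x) = x := by
    intro x hx
    by_contra h
    exact Set.mem_iInter.1 hx [] (hGsub h)
  let e : Equiv.Perm X :=
    { toFun := fun x => if x ∈ Z then s x else x
      invFun := fun x => if x ∈ Z then t x else x
      left_inv := by
        intro x
        by_cases hx : x ∈ Z
        · simp [hx, hZs x hx, (hZinv x hx).2]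
        · simp [hx]
      right_inv := by
        intro x
        by_cases hx : x ∈ Z
        · simp [hx, hZt x hx, (hZinv x hx).1]
        · simp [hx] }
  have he : ∀ᵐ x ∂μ, e x = s x := by
    filter_upwards [hZae] with x hx
    exact if_pos hx
  have he' : ∀ᵐ x ∂μ, e.symm x = t x := by
    filter_upwards [hZae] with x hx
    exact if_pos hx
  have hem : Measurable e := Measurable.ite hZm hs.measurable measurable_id
  have hem' : Measurable e.symm := Measurable.ite hZm ht.measurable measurable_id
  refine ⟨⟨e, ⟨hem, ?_⟩, ⟨hem', ?_⟩⟩, he, he'⟩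
  · rw [Measure.map_congr he, hs.map_eq]
  · rw [Measure.map_congr he', ht.map_eq]

/-! ### The topology of the Halmos metric -/

theorem setDist_eq_preimage (μ : Measure X) (A : Set X) (s t : MPGroup μ) :
    setDist μ A s t = μ.real (symmDiff (s.1.symm ⁻¹' A) (t.1.symm ⁻¹' A)) +
      μ.real (symmDiff (s.1 ⁻¹' A) (t.1 ⁻¹' A)) := by
  unfold setDist
  rw [Equiv.image_eq_preimage_symm, Equiv.image_eq_preimage_symm, Equiv.image_symm_eq_preimage,
    Equiv.image_symm_eq_preimage]

theorem measureReal_symmDiff_preimage {μ : Measure X} {f : X → X} (hf : MeasurePreserving f μ μ)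
    {B C : Set X} (hB : MeasurableSet B) (hC : MeasurableSet C) :
    μ.real (symmDiff (f ⁻¹' B) (f ⁻¹' C)) = μ.real (symmDiff B C) := by
  rw [← Set.preimage_symmDiff, hf.measureReal_preimage (hB.symmDiff hC).nullMeasurableSet]

theorem measureReal_symmDiff_preimage_le {μ : Measure X} [IsProbabilityMeasure μ] {f g : X → X}
    (hf : MeasurePreserving f μ μ) (hg : MeasurePreserving g μ μ) {B C : Set X}
    (hB : MeasurableSet B) (hC : MeasurableSet C) :
    μ.real (symmDiff (f ⁻¹' B) (g ⁻¹' B)) ≤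
      μ.real (symmDiff (f ⁻¹' C) (g ⁻¹' C)) + 2 * μ.real (symmDiff C B) := by
  have h1 := measureReal_symmDiff_triangle μ (f ⁻¹' B) (f ⁻¹' C) (g ⁻¹' B)
  have h2 := measureReal_symmDiff_triangle μ (f ⁻¹' C) (g ⁻¹' C) (g ⁻¹' B)
  rw [measureReal_symmDiff_preimage hf hB hC, symmDiff_comm B C] at h1
  rw [measureReal_symmDiff_preimage hg hC hB] at h2
  linarith

theorem setDist_le_preDist {μ : Measure X} [IsProbabilityMeasure μ] (A : DenseFamily μ)
    (s t : MPGroup μ) (i : ℕ) : (1 / 2 : ℝ) ^ i * setDist μ (A.set i) s t ≤ preDist A s t :=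
  (summable_preDist A s t).le_tsum i
    fun k _ => mul_nonneg (by positivity) (setDist_nonneg μ (A.set k) s t)

theorem exists_preDist_control {μ : Measure X} [IsProbabilityMeasure μ] (A : DenseFamily μ)
    {B : Set X} (hB : MeasurableSet B) {ε : ℝ} (hε : 0 < ε) :
    ∃ δ > 0, ∀ s t : MPGroup μ, preDist A s t < δ →
      μ.real (symmDiff (s.1 ⁻¹' B) (t.1 ⁻¹' B)) < ε ∧
        μ.real (symmDiff (s.1.symm ⁻¹' B) (t.1.symm ⁻¹' B)) < ε := by
  obtain ⟨i, hi⟩ := A.dense B hB (ε / 4) (by positivity)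
  -- The i-th term of the series contributes ε / 4, and replacing B by the i-th set costs twice ε /
  -- 4.
  refine ⟨(1 / 2 : ℝ) ^ i * (ε / 4), by positivity, fun s t h => ?_⟩
  have h1 : setDist μ (A.set i) s t < ε / 4 :=
    lt_of_mul_lt_mul_left ((setDist_le_preDist A s t i).trans_lt h) (by positivity)
  rw [setDist_eq_preimage] at h1
  have n1 : 0 ≤ μ.real (symmDiff (s.1 ⁻¹' A.set i) (t.1 ⁻¹' A.set i)) := measureReal_nonneg
  have n2 : 0 ≤ μ.real (symmDiff (s.1.symm ⁻¹' A.set i) (t.1.symm ⁻¹' A.set i)) :=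
    measureReal_nonneg
  have e1 := measureReal_symmDiff_preimage_le s.2.1 t.2.1 hB (A.measurableSet i)
  have e2 := measureReal_symmDiff_preimage_le s.2.2 t.2.2 hB (A.measurableSet i)
  constructor <;> linarith

theorem tendsto_preDist {μ : Measure X} [IsProbabilityMeasure μ] (A : DenseFamily μ)
    {f : ℕ → MPGroup μ} {t : MPGroup μ}
    (h : ∀ i, Tendsto (fun n => setDist μ (A.set i) (f n) t) atTop (nhds 0)) :
    Tendsto (fun n => preDist A (f n) t) atTop (nhds 0) := by
  have h0 := tendsto_tsum_of_dominated_convergence (𝓕 := atTop)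
    (f := fun n (i : ℕ) => (1 / 2 : ℝ) ^ i * setDist μ (A.set i) (f n) t) (g := fun _ => 0)
    (bound := fun i : ℕ => (1 / 2 : ℝ) ^ i * 2) (summable_geometric_two.mul_right 2)
    (fun i => by simpa using (h i).const_mul ((1 / 2 : ℝ) ^ i))
    (Eventually.of_forall fun n i => by
      rw [Real.norm_of_nonneg (mul_nonneg (by positivity) (setDist_nonneg _ _ _ _))]
      refine mul_le_mul_of_nonneg_left ?_ (by positivity)
      have h1 := measureReal_le_one (μ := μ)
        (s := symmDiff ((f n).1 '' A.set i) (t.1 '' A.set i))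
      have h2 := measureReal_le_one (μ := μ)
        (s := symmDiff ((f n).1.symm '' A.set i) (t.1.symm '' A.set i))
      unfold setDist
      linarith)
  rw [tsum_zero] at h0
  exact h0

theorem halmosDist_eq_preDist_out {μ : Measure X} (A : DenseFamily μ) (S T : Aut μ) :
    halmosDist A S T = preDist A S.out T.out := by
  conv_lhs => rw [← Quotient.out_eq S, ← Quotient.out_eq T]
  rfl

theorem out_mk_ae_eq {μ : Measure X} (s : MPGroup μ) :
    ∀ᵐ x ∂μ, (Quotient.out (s : Aut μ)).1 x = s.1 x :=
  ae_eq_of_rel (Quotient.exact (Quotient.out_eq (s : Aut μ)))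

theorem halmosDist_mk_eq_preDist_out {μ : Measure X} (A : DenseFamily μ) (s : MPGroup μ)
    (T : Aut μ) : halmosDist A (s : Aut μ) T = preDist A s T.out := by
  rw [halmosDist_eq_preDist_out]
  exact preDist_congr A (out_mk_ae_eq s) (Eventually.of_forall fun _ => rfl)

/-! ### Completeness of the Halmos metric -/

/-- Code a point by its memberships in the sets D k. By Borel–Cantelli each bit of the code of g n x
is eventually constant, so the codes converge almost everywhere. Testing against bounded continuous
functions shows that the limit code has the law of c; hence it lies almost surely in the range of c
and can be decoded to a point. -/
theorem exists_limit_of_summable_symmDiff [StandardBorelSpace X] {μ : Measure X}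
    [IsProbabilityMeasure μ] {g : ℕ → X → X} (hg : ∀ n, MeasurePreserving (g n) μ μ)
    {D : ℕ → Set X} (hD : ∀ k, MeasurableSet (D k))
    (hsep : ∀ x y, (∀ k, x ∈ D k ↔ y ∈ D k) → x = y)
    (h : ∀ k n, k ≤ n →
      μ.real (symmDiff (g n ⁻¹' D k) (g (n + 1) ⁻¹' D k)) < (1 / 2 : ℝ) ^ n) :
    ∃ t : X → X, MeasurePreserving t μ μ ∧
      ∀ᵐ x ∂μ, ∀ k, ∀ᶠ n in atTop, (g n x ∈ D k ↔ t x ∈ D k) := by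
  classical
  have hne : Nonempty X := μ.nonempty_of_neZero
  set c : X → ℕ → Bool := fun x k => decide (x ∈ D k) with hc
  have hcm : Measurable c := by
    refine measurable_pi_lambda _ fun k => ?_
    refine measurable_to_bool ?_
    convert hD k using 1
    ext x
    simp [hc]
  have hci : Function.Injective c := by
    intro x y hxy
    refine hsep x y fun k => ?_
    have := congrFun hxy k
    simpa [hc] using this
  have hce : MeasurableEmbedding c := hcm.measurableEmbedding hci
  have hev : ∀ᵐ x ∂μ, ∀ k, ∀ᶠ n in atTop, c (g (n + 1) x) k = c (g n x) k := by
    refine ae_all_iff.2 fun k => ?_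
    -- The hypothesis bounds the k-th set only from index k on, hence the shift.
    have hsum : ∑' n, μ (symmDiff (g (n + k) ⁻¹' D k) (g (n + k + 1) ⁻¹' D k)) ≠ ⊤ := by
      refine ne_top_of_le_ne_top (summable_geometric_two.tsum_ofReal_ne_top) ?_
      refine ENNReal.tsum_le_tsum fun n => ?_
      rw [← ofReal_measureReal]
      refine ENNReal.ofReal_le_ofReal ((h k (n + k) (Nat.le_add_left k n)).le.trans ?_)
      exact pow_le_pow_of_le_one (by norm_num) (by norm_num) (Nat.le_add_right n k)
    filter_upwards [ae_eventually_notMem hsum] with x hx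
    have hx' : ∀ᶠ n in map (fun n => n + k) atTop, c (g (n + 1) x) k = c (g n x) k := by
      rw [eventually_map]
      filter_upwards [hx] with n hn
      simp only [Set.mem_symmDiff, Set.mem_preimage] at hn
      simp only [hc]
      congr 1
      exact propext (by tauto)
    rwa [map_add_atTop_eq_nat] at hx'
  have hconv : ∀ᵐ x ∂μ, ∃ l, Tendsto (fun n => c (g n x)) atTop (nhds l) := by
    filter_upwards [hev] with x hx
    have : ∀ k, ∃ l, ∀ᶠ n in atTop, c (g n x) k = l := by
      intro k
      obtain ⟨N, hN⟩ := eventually_atTop.1 (hx k)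
      refine ⟨c (g N x) k, eventually_atTop.2 ⟨N, fun n hn => ?_⟩⟩
      induction n, hn using Nat.le_induction with
      | base => rfl
      | succ n hn ih => rw [hN n hn, ih]
    choose l hl using this
    refine ⟨l, tendsto_pi_nhds.2 fun k => ?_⟩
    exact tendsto_const_nhds.congr' ((hl k).mono fun n hn => hn.symm)
  obtain ⟨G, hGm, hG⟩ := measurable_limit_of_tendsto_metrizable_ae (μ := μ)
    (fun n => (hcm.comp (hg n).measurable).aemeasurable) hconv
  have hlaw : μ.map G = μ.map c := by
    have := Measure.isProbabilityMeasure_map (μ := μ) hGm.aemeasurable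
    have := Measure.isProbabilityMeasure_map (μ := μ) hcm.aemeasurable
    refine ext_of_forall_integral_eq_of_IsFiniteMeasure fun f => ?_
    rw [integral_map hGm.aemeasurable f.continuous.aestronglyMeasurable,
      integral_map hcm.aemeasurable f.continuous.aestronglyMeasurable]
    have hlim : Tendsto (fun n => ∫ x, f (c (g n x)) ∂μ) atTop (nhds (∫ x, f (G x) ∂μ)) := by
      refine tendsto_integral_of_dominated_convergence (fun _ => ‖f‖)
        (fun n => (f.continuous.measurable.comp
          (hcm.comp (hg n).measurable)).aestronglyMeasurable)
        (integrable_const _) (fun n => Eventually.of_forall fun x => f.norm_coe_le_norm _) ?_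
      filter_upwards [hG] with x hx
      exact (f.continuous.tendsto _).comp hx
    have hconst : ∀ n, ∫ x, f (c (g n x)) ∂μ = ∫ x, f (c x) ∂μ := by
      intro n
      have := integral_map (μ := μ) (hg n).measurable.aemeasurable (f := fun x => f (c x))
        (f.continuous.measurable.comp hcm).aestronglyMeasurable
      rw [(hg n).map_eq] at this
      exact this.symm
    simp only [hconst] at hlim
    exact tendsto_nhds_unique hlim tendsto_const_nhds
  obtain ⟨b, hb, hbc⟩ := hce.exists_measurable_extend measurable_id (fun _ => hne)
  have hbc' : ∀ x, b (c x) = x := fun x => congrFun hbc x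
  have hrange : ∀ᵐ x ∂μ, c (b (G x)) = G x := by
    have h1 : ∀ᵐ y ∂μ.map c, c (b y) = y := by
      rw [hce.ae_map_iff]
      exact Eventually.of_forall fun x => by rw [hbc']
    rw [← hlaw] at h1
    exact ae_of_ae_map hGm.aemeasurable h1
  refine ⟨b ∘ G, ⟨hb.comp hGm, ?_⟩, ?_⟩
  · rw [← Measure.map_map hb hGm, hlaw, Measure.map_map hb hcm, hbc, Measure.map_id]
  · filter_upwards [hG, hrange] with x hx hx' k
    have h1 := tendsto_pi_nhds.1 hx k
    rw [← hx', nhds_discrete, tendsto_pure] at h1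
    filter_upwards [h1] with n hn
    simpa [hc] using hn

theorem tendsto_measureReal_symmDiff_of_eventually {μ : Measure X} [IsProbabilityMeasure μ]
    {g : ℕ → X → X} {t : X → X} (hg : ∀ n, Measurable (g n)) (ht : Measurable t) {D : Set X}
    (hD : MeasurableSet D) (h : ∀ᵐ x ∂μ, ∀ᶠ n in atTop, (g n x ∈ D ↔ t x ∈ D)) :
    Tendsto (fun n => μ.real (symmDiff (g n ⁻¹' D) (t ⁻¹' D))) atTop (nhds 0) := by
  have := tendsto_measure_of_ae_tendsto_indicator_of_isFiniteMeasure (μ := μ) (L := atTop)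
    (A := ∅) (As := fun n => symmDiff (g n ⁻¹' D) (t ⁻¹' D)) MeasurableSet.empty
    (fun n => (hg n hD).symmDiff (ht hD)) (by
      filter_upwards [h] with x hx
      filter_upwards [hx] with n hn
      simp only [Set.mem_symmDiff, Set.mem_preimage, Set.mem_empty_iff_false, iff_false]
      tauto)
  have h2 := (ENNReal.tendsto_toReal (measure_ne_top μ ∅)).comp this
  rw [measure_empty, ENNReal.toReal_zero] at h2
  exact h2

theorem tendsto_measureReal_symmDiff_of_dense {μ : Measure X} [IsProbabilityMeasure μ]
    (A : DenseFamily μ) {g : ℕ → X → X} {t : X → X} (hg : ∀ n, MeasurePreserving (g n) μ μ)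
    (ht : MeasurePreserving t μ μ)
    (h : ∀ i, Tendsto (fun n => μ.real (symmDiff (g n ⁻¹' A.set i) (t ⁻¹' A.set i)))
      atTop (nhds 0)) {B : Set X} (hB : MeasurableSet B) :
    Tendsto (fun n => μ.real (symmDiff (g n ⁻¹' B) (t ⁻¹' B))) atTop (nhds 0) := by
  refine (nhds_basis_zero_abs_lt ℝ).tendsto_right_iff.2 fun ε hε => ?_
  obtain ⟨i, hi⟩ := A.dense B hB (ε / 4) (by positivity)
  filter_upwards [(h i).eventually_lt_const (show (0 : ℝ) < ε / 4 by positivity)] with n hn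
  have := measureReal_symmDiff_preimage_le (hg n) ht hB (A.measurableSet i)
  change |_| < ε
  rw [abs_of_nonneg measureReal_nonneg]
  linarith

/-- Passing to the limit in the fact that e n and its inverse cancel: `h2` compares the preimage of
t⁻¹U under r with that under the inverse of e n, and `h1` compares t⁻¹U with the preimage of U under
e n. -/
theorem ae_comp_eq_id_of_tendsto [StandardBorelSpace X] {μ : Measure X} [IsProbabilityMeasure μ]
    {e : ℕ → MPGroup μ} {t r : X → X} (ht : MeasurePreserving t μ μ)
    (h1 : ∀ B, MeasurableSet B →
      Tendsto (fun n => μ.real (symmDiff ((e n).1 ⁻¹' B) (t ⁻¹' B))) atTop (nhds 0))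
    (h2 : ∀ B, MeasurableSet B →
      Tendsto (fun n => μ.real (symmDiff ((e n).1.symm ⁻¹' B) (r ⁻¹' B))) atTop (nhds 0)) :
    ∀ᵐ x ∂μ, t (r x) = x := by
  refine Filter.EventuallyEq.of_forall_separating_preimage (l := ae μ) (f := fun x => t (r x))
    (g := fun x => x) MeasurableSet fun U hU => ?_
  rw [← measure_symmDiff_eq_zero_iff, ← measureReal_eq_zero_iff]
  have hC : MeasurableSet (t ⁻¹' U) := ht.measurable hU
  have key : ∀ n, μ.real (symmDiff ((fun x => t (r x)) ⁻¹' U) ((fun x => x) ⁻¹' U)) ≤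
      μ.real (symmDiff ((e n).1.symm ⁻¹' (t ⁻¹' U)) (r ⁻¹' (t ⁻¹' U))) +
        μ.real (symmDiff ((e n).1 ⁻¹' U) (t ⁻¹' U)) := by
    intro n
    have e1 := measureReal_symmDiff_triangle μ (r ⁻¹' (t ⁻¹' U))
      ((e n).1.symm ⁻¹' (t ⁻¹' U)) U
    have e2 := measureReal_symmDiff_preimage (e n).2.2 hC ((e n).2.1.measurable hU)
    have e3 : (e n).1.symm ⁻¹' ((e n).1 ⁻¹' U) = U := by
      ext x
      simp
    rw [e3, symmDiff_comm (t ⁻¹' U)] at e2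
    rw [e2, symmDiff_comm (r ⁻¹' (t ⁻¹' U)) ((e n).1.symm ⁻¹' (t ⁻¹' U))] at e1
    exact e1
  refine le_antisymm ?_ measureReal_nonneg
  refine ge_of_tendsto ((h2 _ hC).add (h1 U hU)) (Eventually.of_forall key) |>.trans_eq ?_
  simp

theorem exists_preDist_control_finite {μ : Measure X} [IsProbabilityMeasure μ] (A : DenseFamily μ)
    {D : ℕ → Set X} (hD : ∀ k, MeasurableSet (D k)) {ε : ℝ} (hε : 0 < ε) (N : ℕ) :
    ∃ δ > 0, ∀ s t : MPGroup μ, preDist A s t < δ → ∀ k < N,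
      μ.real (symmDiff (s.1 ⁻¹' D k) (t.1 ⁻¹' D k)) < ε ∧
        μ.real (symmDiff (s.1.symm ⁻¹' D k) (t.1.symm ⁻¹' D k)) < ε := by
  induction N with
  | zero => exact ⟨1, one_pos, fun s t _ k hk => absurd hk (Nat.not_lt_zero k)⟩
  | succ N ih =>
    obtain ⟨δ, hδ, h⟩ := ih
    obtain ⟨δ', hδ', h'⟩ := exists_preDist_control A (hD N) hε
    refine ⟨min δ δ', lt_min hδ hδ', fun s t hst k hk => ?_⟩
    rcases Nat.lt_succ_iff_lt_or_eq.1 hk with hk | rfl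
    · exact h s t (hst.trans_le (min_le_left _ _)) k hk
    · exact h' s t (hst.trans_le (min_le_right _ _))

/-- Separation of points is needed for coding, and containing the dense family for convergence in
the Halmos metric; interleaving two sequences gives both. -/
theorem exists_separating_sequence [StandardBorelSpace X] {μ : Measure X} (A : DenseFamily μ) :
    ∃ D : ℕ → Set X, (∀ k, MeasurableSet (D k)) ∧ (∀ x y, (∀ k, x ∈ D k ↔ y ∈ D k) → x = y) ∧
      ∀ i, ∃ k, D k = A.set i := by
  obtain ⟨c, hc, hci⟩ := MeasurableSpace.measurable_injection_nat_bool_of_countablySeparated X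
  refine ⟨fun k => Sum.elim (fun n => {x | c x n = true}) A.set (Equiv.natSumNatEquivNat.symm k),
    fun k => ?_, fun x y h => hci (funext fun n => ?_), fun i => ?_⟩
  · beta_reduce
    rcases Equiv.natSumNatEquivNat.symm k with n | n
    · exact (measurable_pi_apply n).comp hc (measurableSet_singleton true)
    · exact A.measurableSet n
  · have := h (Equiv.natSumNatEquivNat (Sum.inl n))
    simp only [Equiv.symm_apply_apply, Sum.elim_inl] at this
    exact Bool.eq_iff_iff.2 this
  · exact ⟨Equiv.natSumNatEquivNat (Sum.inr i), by simp⟩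

/-- Along a rapidly Cauchy sequence the maps and their inverses converge separately, and the two
limits are inverse to each other almost everywhere. -/
theorem completeSpace_halmos [StandardBorelSpace X] {μ : Measure X} [IsProbabilityMeasure μ]
    (A : DenseFamily μ) : letI := halmosMetricSpace A; CompleteSpace (Aut μ) := by
  let := halmosMetricSpace A
  obtain ⟨D, hD, hsep, hDA⟩ := exists_separating_sequence A
  choose δ hδ hδ' using fun N : ℕ =>
    exists_preDist_control_finite A hD (ε := (1 / 2 : ℝ) ^ N) (by positivity) (N + 1)
  refine Metric.complete_of_convergent_controlled_sequences δ hδ fun u hu => ?_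
  have hctl : ∀ k n, k ≤ n →
      μ.real (symmDiff ((u n).out.1 ⁻¹' D k) ((u (n + 1)).out.1 ⁻¹' D k)) < (1 / 2 : ℝ) ^ n ∧
      μ.real (symmDiff ((u n).out.1.symm ⁻¹' D k) ((u (n + 1)).out.1.symm ⁻¹' D k))
        < (1 / 2 : ℝ) ^ n := by
    intro k n hkn
    refine hδ' n _ _ ?_ k (Nat.lt_succ_of_le hkn)
    have h : halmosDist A (u n) (u (n + 1)) < δ n := hu n n (n + 1) le_rfl (Nat.le_succ n)
    rwa [halmosDist_eq_preDist_out] at h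
  obtain ⟨t, ht, hta⟩ := exists_limit_of_summable_symmDiff (fun n => (u n).out.2.1) hD hsep
    fun k n hkn => (hctl k n hkn).1
  obtain ⟨r, hr, hra⟩ := exists_limit_of_summable_symmDiff (fun n => (u n).out.2.2) hD hsep
    fun k n hkn => (hctl k n hkn).2
  have h1 : ∀ i, Tendsto (fun n => μ.real (symmDiff ((u n).out.1 ⁻¹' A.set i) (t ⁻¹' A.set i)))
      atTop (nhds 0) := by
    intro i
    obtain ⟨k, hk⟩ := hDA i
    rw [← hk]
    exact tendsto_measureReal_symmDiff_of_eventually (fun n => (u n).out.2.1.measurable)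
      ht.measurable (hD k) (hta.mono fun x hx => hx k)
  have h2 : ∀ i, Tendsto
      (fun n => μ.real (symmDiff ((u n).out.1.symm ⁻¹' A.set i) (r ⁻¹' A.set i)))
      atTop (nhds 0) := by
    intro i
    obtain ⟨k, hk⟩ := hDA i
    rw [← hk]
    exact tendsto_measureReal_symmDiff_of_eventually (fun n => (u n).out.2.2.measurable)
      hr.measurable (hD k) (hra.mono fun x hx => hx k)
  have h1' := fun B hB => tendsto_measureReal_symmDiff_of_dense A (fun n => (u n).out.2.1) ht h1
    (B := B) hB
  have h2' := fun B hB => tendsto_measureReal_symmDiff_of_dense A (fun n => (u n).out.2.2) hr h2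
    (B := B) hB
  have htr := ae_comp_eq_id_of_tendsto (e := fun n => (u n).out) ht h1' h2'
  have hrt := ae_comp_eq_id_of_tendsto (e := fun n => (u n).out⁻¹) hr h2' h1'
  obtain ⟨e, het, her⟩ := exists_mpGroup_ae_eq ht hr htr hrt
  refine ⟨(e : Aut μ), tendsto_iff_dist_tendsto_zero.2 ?_⟩
  have hdist : ∀ n, dist (u n) (e : Aut μ) = preDist A (u n).out e := by
    intro n
    rw [dist_comm]
    change halmosDist A (e : Aut μ) (u n) = _
    rw [halmosDist_mk_eq_preDist_out]
    simp only [preDist, setDist, symmDiff_comm]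
  simp only [hdist]
  refine tendsto_preDist A fun i => ?_
  have := (h2 i).add (h1 i)
  rw [add_zero] at this
  refine this.congr fun n => ?_
  rw [setDist_eq_preimage]
  have c1 : (e.1 ⁻¹' A.set i : Set X) =ᵐ[μ] t ⁻¹' A.set i := by
    filter_upwards [het] with x hx
    change (e.1 x ∈ A.set i) = (t x ∈ A.set i)
    rw [hx]
  have c2 : (e.1.symm ⁻¹' A.set i : Set X) =ᵐ[μ] r ⁻¹' A.set i := by
    filter_upwards [her] with x hx
    change (e.1.symm x ∈ A.set i) = (r x ∈ A.set i)
    rw [hx]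
  rw [measureReal_congr ((ae_eq_refl _).symmDiff c1), measureReal_congr ((ae_eq_refl _).symmDiff c2)]

/-! ### Continuity of the entropy of finite itineraries -/

/-- Induction, inserting the S-preimage of the n-th T-preimage of B: one difference is the previous
step because S preserves μ, the other is the one-step case for a set that does not depend on S. -/
theorem tendsto_preimage_iterate [StandardBorelSpace X] {μ : Measure X} [IsProbabilityMeasure μ]
    (A : DenseFamily μ) (T : Aut μ) {B : Set X} (hB : MeasurableSet B) (n : ℕ) :
    letI := halmosMetricSpace A
    Tendsto (fun S : Aut μ => μ.real (symmDiff (S.out.1^[n] ⁻¹' B) (T.out.1^[n] ⁻¹' B)))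
      (nhds T) (nhds 0) := by
  let := halmosMetricSpace A
  have hone : ∀ C, MeasurableSet C → Tendsto (fun S : Aut μ =>
      μ.real (symmDiff (S.out.1 ⁻¹' C) (T.out.1 ⁻¹' C))) (nhds T) (nhds 0) := by
    intro C hC
    refine (nhds_basis_zero_abs_lt ℝ).tendsto_right_iff.2 fun ε hε => ?_
    obtain ⟨δ, hδ, h⟩ := exists_preDist_control A hC hε
    filter_upwards [Metric.ball_mem_nhds T hδ] with S hS
    have hS' : halmosDist A S T < δ := hS
    rw [halmosDist_eq_preDist_out] at hS'
    change |_| < ε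
    rw [abs_of_nonneg measureReal_nonneg]
    exact (h _ _ hS').1
  induction n with
  | zero => simp
  | succ n ih =>
    have hC : MeasurableSet (T.out.1^[n] ⁻¹' B) := (T.out.2.1.measurable.iterate n) hB
    refine squeeze_zero (fun _ => measureReal_nonneg) (fun S => ?_)
      (by simpa using ih.add (hone _ hC))
    have h1 := measureReal_symmDiff_triangle μ (S.out.1 ⁻¹' (S.out.1^[n] ⁻¹' B))
      (S.out.1 ⁻¹' (T.out.1^[n] ⁻¹' B)) (T.out.1 ⁻¹' (T.out.1^[n] ⁻¹' B))
    rw [measureReal_symmDiff_preimage S.out.2.1 ((S.out.2.1.measurable.iterate n) hB) hC] at h1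
    exact h1

theorem abs_measureReal_iInter_sub_le {ι : Type*} [Fintype ι] {μ : Measure X}
    [IsProbabilityMeasure μ] {E F : ι → Set X} (hE : ∀ i, MeasurableSet (E i))
    (hF : ∀ i, MeasurableSet (F i)) :
    |μ.real (⋂ i, E i) - μ.real (⋂ i, F i)| ≤ ∑ i, μ.real (symmDiff (E i) (F i)) := by
  have h1 := abs_measureReal_sub_le_measureReal_symmDiff (μ := μ)
    (MeasurableSet.iInter hE).nullMeasurableSet (MeasurableSet.iInter hF).nullMeasurableSet
  refine h1.trans ?_
  refine le_trans (measureReal_mono ?_) (measureReal_iUnion_fintype_le fun i => symmDiff (E i) (F i))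
  intro x hx
  simp only [Set.mem_symmDiff, Set.mem_iInter, Set.mem_iUnion] at hx ⊢
  rcases hx with ⟨h, h'⟩ | ⟨h, h'⟩
  · obtain ⟨i, hi⟩ := not_forall.1 h'
    exact ⟨i, Or.inl ⟨h i, hi⟩⟩
  · obtain ⟨i, hi⟩ := not_forall.1 h'
    exact ⟨i, Or.inr ⟨h i, hi⟩⟩

theorem continuous_partitionEntropy_itinerary [StandardBorelSpace X] {μ : Measure X}
    [IsProbabilityMeasure μ] (A : DenseFamily μ) {k : ℕ} {ξ : X → Fin k} (hξ : FiniteMeas ξ)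
    (j n : ℕ) :
    letI := halmosMetricSpace A
    Continuous fun S : Aut μ => partitionEntropy μ (itinerary S.out.1^[j] ξ n) := by
  let := halmosMetricSpace A
  unfold partitionEntropy
  refine continuous_finsetSum _ fun a _ => Real.continuous_negMulLog.comp ?_
  refine continuous_iff_continuousAt.2 fun T => ?_
  have hpre : ∀ S : Aut μ, itinerary S.out.1^[j] ξ n ⁻¹' {a} =
      ⋂ i : Fin n, S.out.1^[j * i] ⁻¹' (ξ ⁻¹' {a i}) := by
    intro S
    ext x
    simp [itinerary, funext_iff, Function.iterate_mul]
  have hm : ∀ (S : Aut μ) (i : Fin n), MeasurableSet (S.out.1^[j * i] ⁻¹' (ξ ⁻¹' {a i})) :=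
    fun S i => (S.out.2.1.measurable.iterate _) (hξ _)
  rw [ContinuousAt, tendsto_iff_dist_tendsto_zero]
  have hsum : Tendsto (fun S : Aut μ => ∑ i : Fin n, μ.real (symmDiff
      (S.out.1^[j * i] ⁻¹' (ξ ⁻¹' {a i})) (T.out.1^[j * i] ⁻¹' (ξ ⁻¹' {a i})))) (nhds T)
      (nhds 0) := by
    simpa using tendsto_finsetSum Finset.univ
      fun (i : Fin n) _ => tendsto_preimage_iterate A T (hξ (a i)) (j * i)
  refine squeeze_zero (fun _ => dist_nonneg) (fun S => ?_) hsum
  rw [hpre, hpre, Real.dist_eq]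
  exact abs_measureReal_iInter_sub_le (hm S) (hm T)

/-! ### Compact sets of transformations of zero entropy -/

theorem eventually_partitionEntropy_itinerary_lt {μ : Measure X} [IsProbabilityMeasure μ]
    {S : Aut μ} (hS : ksEntropy S = 0) {k : ℕ} {ξ : X → Fin k} (hξ : Measurable ξ) {j : ℕ}
    (hj : 0 < j) {ε : ℝ} (hε : 0 < ε) :
    ∀ᶠ n : ℕ in atTop, partitionEntropy μ (itinerary S.out.1^[j] ξ n) < n * ε := by
  have hξ' : FiniteMeas ξ := fun a => hξ (measurableSet_singleton a)
  have h0 : mapEntropy μ S.out.1 = 0 := by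
    rw [← Quotient.out_eq S] at hS
    exact hS
  have h1 : entropyWrt μ S.out.1 ξ = 0 := by
    refine le_antisymm (h0 ▸ ?_) bot_le
    exact le_iSup_of_le k (le_iSup_of_le ξ (le_iSup_of_le hξ le_rfl))
  have hj' : (0 : ℝ) < j := Nat.cast_pos.2 hj
  -- Tolerance ε / j over length j * n becomes n * ε for the j-th power.
  have h2 : ∀ᶠ n : ℕ in atTop, ENNReal.ofReal
      (partitionEntropy μ (itinerary S.out.1 ξ n) / n) < ENNReal.ofReal (ε / j) := by
    refine eventually_lt_of_limsup_lt ?_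
    change entropyWrt μ S.out.1 ξ < _
    rw [h1, ENNReal.ofReal_pos]
    positivity
  have h3 : Tendsto (fun n : ℕ => j * n) atTop atTop :=
    tendsto_id.const_mul_atTop' hj
  filter_upwards [h3.eventually h2, eventually_gt_atTop 0] with n hn hn0
  have hn0' : (0 : ℝ) < n := Nat.cast_pos.2 hn0
  have hn' := (ENNReal.ofReal_lt_ofReal_iff (by positivity)).1 hn
  push_cast at hn'
  rw [div_lt_iff₀ (by positivity)] at hn'
  refine (partitionEntropy_itinerary_iterate_le S.out.2.1.measurable hξ' hj n).trans_lt
    (hn'.trans_eq ?_)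
  field_simp

/-- A length that works at S works nearby, since the strict bound is an open condition. Lengths for
two pieces of K merge into their product, because the bound passes to multiples. -/
theorem exists_uniform_itinerary_length [StandardBorelSpace X] {μ : Measure X}
    [IsProbabilityMeasure μ] (A : DenseFamily μ) {K : Set (Aut μ)} :
    letI := halmosMetricSpace A
    IsCompact K → (∀ S ∈ K, ksEntropy S = 0) → ∀ (M j : ℕ), 0 < j → ∀ ε : ℝ, 0 < ε →
      ∃ L : ℕ, 0 < L ∧ ∀ S ∈ K, ∀ m < M,
        partitionEntropy μ (itinerary S.out.1^[j] (twoSet (A.set m)) L) ≤ L * ε := by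
  let := halmosMetricSpace A
  intro hK hK0 M j hj ε hε
  have hmeas : ∀ m, FiniteMeas (twoSet (A.set m)) := fun m => finiteMeas_twoSet (A.measurableSet m)
  have hmul : ∀ (S : Aut μ) (m a b : ℕ),
      partitionEntropy μ (itinerary S.out.1^[j] (twoSet (A.set m)) b) ≤ b * ε →
      partitionEntropy μ (itinerary S.out.1^[j] (twoSet (A.set m)) (a * b)) ≤
        (a * b : ℕ) * ε := by
    intro S m a b h
    refine (partitionEntropy_itinerary_mul_le (S.out.2.1.iterate j) (hmeas m) a b).trans ?_
    push_cast
    rw [mul_assoc]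
    exact mul_le_mul_of_nonneg_left h (Nat.cast_nonneg a)
  refine hK.induction_on (p := fun s => ∃ L : ℕ, 0 < L ∧ ∀ S ∈ s, ∀ m < M,
    partitionEntropy μ (itinerary S.out.1^[j] (twoSet (A.set m)) L) ≤ L * ε) ?_ ?_ ?_ ?_
  · exact ⟨1, one_pos, fun S hS => absurd hS (Set.notMem_empty S)⟩
  · rintro s t hst ⟨L, hL, h⟩
    exact ⟨L, hL, fun S hS => h S (hst hS)⟩
  · rintro s t ⟨L, hL, h⟩ ⟨L', hL', h'⟩
    refine ⟨L * L', Nat.mul_pos hL hL', fun S hS m hm => ?_⟩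
    rcases hS with hS | hS
    · rw [mul_comm L L']
      exact hmul S m L' L (h S hS m hm)
    · exact hmul S m L L' (h' S hS m hm)
  · intro S hS
    have h1 : ∀ᶠ n : ℕ in atTop, ∀ m ∈ Set.Iio M,
        partitionEntropy μ (itinerary S.out.1^[j] (twoSet (A.set m)) n) < n * ε :=
      (eventually_all_finite (Set.finite_Iio M)).2 fun m _ =>
        eventually_partitionEntropy_itinerary_lt (hK0 S hS)
          (measurable_twoSet (A.measurableSet m)) hj hε
    obtain ⟨n, hn, hn0⟩ := (h1.and (eventually_gt_atTop 0)).exists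
    have h2 : ∀ᶠ S' in nhds S, ∀ m ∈ Set.Iio M,
        partitionEntropy μ (itinerary S'.out.1^[j] (twoSet (A.set m)) n) < n * ε :=
      (eventually_all_finite (Set.finite_Iio M)).2 fun m hm =>
        (continuous_partitionEntropy_itinerary A (hmeas m) j n).continuousAt.eventually_lt_const
          (hn m hm)
    exact ⟨_, mem_nhdsWithin_of_mem_nhds h2, n, hn0, fun S' hS' m hm => (hS' m hm).le⟩

/-! ### A skew product over a cyclic clock -/

/-- The map `(c, y) ↦ (c + 1, s ∘ y)` with an additional rotation of the coordinates of `y`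
whenever the clock `c` shows `0`. -/
def clockMap {Y : Type*} (q L : ℕ) [NeZero q] [NeZero L] (s : Y → Y) (p : Fin q × (Fin L → Y)) :
    Fin q × (Fin L → Y) :=
  (p.1 + 1, fun k => s (p.2 (k + if p.1 = 0 then 1 else 0)))

/-- The inverse of `clockMap` if `r` is the inverse of `s`. -/
def clockMapInv {Y : Type*} (q L : ℕ) [NeZero q] [NeZero L] (r : Y → Y)
    (p : Fin q × (Fin L → Y)) : Fin q × (Fin L → Y) :=
  (p.1 - 1, fun k => r (p.2 (k + -(if p.1 - 1 = 0 then 1 else 0))))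

/-- The uniform probability measure on the clock times the product measure. -/
def clockMeasure (q L : ℕ) (μ : Measure X) : Measure (Fin q × (Fin L → X)) :=
  ((q : ENNReal)⁻¹ • Measure.count).prod (Measure.pi fun _ => μ)

theorem isProbabilityMeasure_uniform (q : ℕ) [NeZero q] :
    IsProbabilityMeasure ((q : ENNReal)⁻¹ • (Measure.count : Measure (Fin q))) where
  measure_univ := by
    simp only [Measure.smul_apply, Measure.count_univ, smul_eq_mul, ENat.card_eq_coe_fintype_card,
      Fintype.card_fin]
    exact ENNReal.inv_mul_cancel (by simpa using NeZero.ne q) (by simp)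

theorem measurePreserving_uniform_add (q : ℕ) [NeZero q] (d : Fin q) :
    MeasurePreserving (fun c : Fin q => c + d) ((q : ENNReal)⁻¹ • Measure.count)
      ((q : ENNReal)⁻¹ • Measure.count) := by
  refine ⟨measurable_of_countable _, ?_⟩
  refine Measure.ext_iff_singleton.2 fun c => ?_
  rw [Measure.map_apply (measurable_of_countable _) (measurableSet_singleton c)]
  have : (fun c : Fin q => c + d) ⁻¹' {c} = {c - d} := by
    ext x
    exact eq_sub_iff_add_eq.symm
  simp [this]

theorem measurePreserving_pi_comp_add {μ : Measure X} [IsProbabilityMeasure μ] (L : ℕ) [NeZero L]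
    {s : X → X} (hs : MeasurePreserving s μ μ) (d : Fin L) :
    MeasurePreserving (fun (y : Fin L → X) k => s (y (k + d))) (Measure.pi fun _ => μ)
      (Measure.pi fun _ => μ) := by
  have hm : Measurable fun (y : Fin L → X) k => s (y (k + d)) :=
    measurable_pi_lambda _ fun k => hs.measurable.comp (measurable_pi_apply _)
  refine ⟨hm, (Measure.pi_eq fun S hS => ?_).symm⟩
  rw [Measure.map_apply hm (MeasurableSet.univ_pi hS)]
  have : (fun (y : Fin L → X) k => s (y (k + d))) ⁻¹' Set.univ.pi S =
      Set.univ.pi fun k => s ⁻¹' S (k - d) := by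
    ext y
    simp only [Set.mem_preimage, Set.mem_univ_pi]
    constructor
    · intro h k
      simpa using h (k - d)
    · intro h k
      simpa using h (k + d)
  rw [this, Measure.pi_pi]
  simp only [hs.measure_preimage (hS _).nullMeasurableSet]
  exact Equiv.prod_comp (Equiv.subRight d) fun k => μ (S k)

section

variable {μ : Measure X} [IsProbabilityMeasure μ] (q L : ℕ) [NeZero q] [NeZero L]

instance isProbabilityMeasure_clockMeasure : IsProbabilityMeasure (clockMeasure q L μ) := by
  have := isProbabilityMeasure_uniform q
  unfold clockMeasure
  infer_instance

instance nullSingletonClass_clockMeasure [NullSingletonClass μ] :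
    NullSingletonClass (clockMeasure q L μ) := by
  unfold clockMeasure
  infer_instance

theorem measurePreserving_clockMap {s : X → X} (hs : MeasurePreserving s μ μ) :
    MeasurePreserving (clockMap q L s) (clockMeasure q L μ) (clockMeasure q L μ) := by
  have := isProbabilityMeasure_uniform q
  refine MeasurePreserving.skew_product
    (g := fun (c : Fin q) (y : Fin L → X) k => s (y (k + if c = 0 then 1 else 0)))
    (measurePreserving_uniform_add q 1) ?_ ?_
  · exact measurable_from_prod_countable_right fun c =>
      (measurePreserving_pi_comp_add L hs (if c = 0 then 1 else 0)).measurable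
  · exact Eventually.of_forall fun c => (measurePreserving_pi_comp_add L hs _).map_eq

theorem measurePreserving_clockMapInv {r : X → X} (hr : MeasurePreserving r μ μ) :
    MeasurePreserving (clockMapInv q L r) (clockMeasure q L μ) (clockMeasure q L μ) := by
  have := isProbabilityMeasure_uniform q
  have h := measurePreserving_uniform_add q (-1)
  simp only [← sub_eq_add_neg] at h
  refine MeasurePreserving.skew_product
    (g := fun (c : Fin q) (y : Fin L → X) k => r (y (k + -(if c - 1 = 0 then 1 else 0))))
    h ?_ ?_
  · exact measurable_from_prod_countable_right fun c =>
      (measurePreserving_pi_comp_add L hr (-(if c - 1 = 0 then 1 else 0))).measurable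
  · exact Eventually.of_forall fun c => (measurePreserving_pi_comp_add L hr _).map_eq

theorem measurePreserving_clock_eval :
    MeasurePreserving (fun p : Fin q × (Fin L → X) => p.2 0) (clockMeasure q L μ) μ := by
  have := isProbabilityMeasure_uniform q
  exact (measurePreserving_eval (fun _ : Fin L => μ) 0).comp measurePreserving_snd

end

theorem clockMeasure_clock_eq_zero {μ : Measure X} [IsProbabilityMeasure μ] (q L : ℕ)
    [NeZero q] :
    (clockMeasure q L μ).real {p | p.1 = 0} = 1 / q := by
  have e : {p : Fin q × (Fin L → X) | p.1 = 0} = {0} ×ˢ Set.univ := by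
    ext p
    simp
  rw [e, clockMeasure, measureReal_prod_prod]
  simp [measureReal_def]

theorem clockMeasure_pi {μ : Measure X} [IsProbabilityMeasure μ] (q L : ℕ) [NeZero q] {S : Fin L → Set X} :
    (clockMeasure q L μ).real {p | ∀ k, p.2 k ∈ S k} = ∏ k, μ.real (S k) := by
  have := isProbabilityMeasure_uniform q
  have e : {p : Fin q × (Fin L → X) | ∀ k, p.2 k ∈ S k} = Set.univ ×ˢ Set.univ.pi S := by
    ext p
    simp
  rw [e, clockMeasure, measureReal_prod_prod]
  simp [measureReal_def, Measure.pi_pi, ENNReal.toReal_prod]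

theorem clockMap_clockMapInv {Y : Type*} (q L : ℕ) [NeZero q] [NeZero L] {s r : Y → Y}
    (h : ∀ y, s (r y) = y) (p : Fin q × (Fin L → Y)) :
    clockMap q L s (clockMapInv q L r p) = p := by
  refine Prod.ext ?_ (funext fun k => ?_)
  · simp [clockMap, clockMapInv]
  · simp only [clockMap, clockMapInv, h]
    exact congrArg p.2 (add_neg_cancel_right _ _)

theorem clockMapInv_clockMap {Y : Type*} (q L : ℕ) [NeZero q] [NeZero L] {s r : Y → Y}
    (h : ∀ y, r (s y) = y) (p : Fin q × (Fin L → Y)) :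
    clockMapInv q L r (clockMap q L s p) = p := by
  refine Prod.ext ?_ (funext fun k => ?_)
  · simp [clockMap, clockMapInv]
  · simp [clockMap, clockMapInv, h]

open scoped Fin.CommRing in
theorem clockMap_iterate {Y : Type*} (q L : ℕ) [NeZero q] [NeZero L] (s : Y → Y)
    (p : Fin q × (Fin L → Y)) (n : ℕ) :
    (clockMap q L s)^[n] p = (p.1 + (n : Fin q), fun k => s^[n] (p.2
      (k + ∑ t ∈ Finset.range n, if p.1 + (t : Fin q) = 0 then 1 else 0))) := by
  induction n with
  | zero => simp
  | succ n ih =>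
    rw [Function.iterate_succ_apply', ih]
    refine Prod.ext ?_ (funext fun k => ?_)
    · simp [clockMap, add_assoc]
    · simp only [clockMap, ← Function.iterate_succ_apply' s, Finset.sum_range_succ]
      refine congrArg (fun i => s^[n + 1] (p.2 i)) ?_
      exact (add_assoc _ _ _).trans (congrArg _ (add_comm _ _))

open scoped Fin.CommRing in
-- The clock shows 0 exactly once in q consecutive steps, so the coordinates rotate by exactly one
-- place.
theorem clockMap_iterate_period {Y : Type*} (q L : ℕ) [NeZero q] [NeZero L] (s : Y → Y)
    (p : Fin q × (Fin L → Y)) :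
    (clockMap q L s)^[q] p = (p.1, fun k => s^[q] (p.2 (k + 1))) := by
  rw [clockMap_iterate]
  have h : ∑ t ∈ Finset.range q, (if p.1 + (t : Fin q) = 0 then (1 : Fin L) else 0) = 1 := by
    rw [Finset.sum_range fun t => if p.1 + (t : Fin q) = 0 then (1 : Fin L) else 0]
    simp [add_eq_zero_iff_eq_neg']
  rw [h]
  simp

open scoped Fin.CommRing in
theorem clockMap_iterate_iterate_period {Y : Type*} (q L : ℕ) [NeZero q] [NeZero L] (s : Y → Y)
    (p : Fin q × (Fin L → Y)) (i : ℕ) :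
    ((clockMap q L s)^[q])^[i] p = (p.1, fun k => (s^[q])^[i] (p.2 (k + (i : Fin L)))) := by
  induction i with
  | zero => simp
  | succ i ih =>
    rw [Function.iterate_succ_apply', ih, clockMap_iterate_period]
    simp only [← Function.iterate_succ_apply' (s^[q])]
    refine Prod.ext rfl (funext fun k => ?_)
    simp only [Nat.cast_add, Nat.cast_one]
    refine congrArg (fun l => (s^[q])^[i + 1] (p.2 l)) ?_
    exact (add_assoc _ _ _).trans (congrArg _ (add_comm _ _))

theorem clockMap_iterate_iterate_period_zero {Y : Type*} (q L : ℕ) [NeZero q] [NeZero L]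
    (s : Y → Y) (p : Fin q × (Fin L → Y)) (i : Fin L) :
    (((clockMap q L s)^[q])^[(i : ℕ)] p).2 0 = (s^[q])^[(i : ℕ)] (p.2 i) := by
  rw [clockMap_iterate_iterate_period]
  simp

/-! ### Perturbation to independence along an arithmetic progression -/

theorem partitionEntropy_of_uniform {Y : Type*} [MeasurableSpace Y] {ν : Measure Y} {L : ℕ}
    {G : Y → Fin L → Fin 2} (h : ∀ a, ν.real (G ⁻¹' {a}) = (1 / 2 : ℝ) ^ L) :
    partitionEntropy ν G = L * Real.log 2 := by
  unfold partitionEntropy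
  simp only [h, Finset.sum_const, Finset.card_univ, Fintype.card_fun, Fintype.card_fin,
    nsmul_eq_mul, Real.negMulLog, Real.log_pow, one_div, Real.log_inv, inv_pow]
  push_cast
  field_simp

/-- The i-th sample depends only on the i-th coordinate, so prescribing a word imposes one condition
of measure 1/2 on each independent coordinate. -/
theorem partitionEntropy_clock {μ : Measure X} [IsProbabilityMeasure μ] (q L : ℕ) [NeZero q]
    [NeZero L] {s : X → X} (hs : MeasurePreserving s μ μ) {B : Set X} (hB : MeasurableSet B)
    (hB2 : μ.real B = 1 / 2) :
    partitionEntropy (clockMeasure q L μ)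
      (fun p (i : Fin L) => twoSet B ((((clockMap q L s)^[q])^[(i : ℕ)] p).2 0)) =
        L * Real.log 2 := by
  refine partitionEntropy_of_uniform fun a => ?_
  have e : (fun p (i : Fin L) => twoSet B ((((clockMap q L s)^[q])^[(i : ℕ)] p).2 0)) ⁻¹' {a} =
      {p | ∀ k : Fin L, p.2 k ∈ (s^[q])^[(k : ℕ)] ⁻¹' (twoSet B ⁻¹' {a k})} := by
    ext p
    simp only [clockMap_iterate_iterate_period_zero]
    simp [funext_iff]
  have hfib : ∀ b, μ.real (twoSet B ⁻¹' {b}) = 1 / 2 := by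
    intro b
    fin_cases b
    · change μ.real (twoSet B ⁻¹' {0}) = 1 / 2
      rw [twoSet_preimage_zero, probReal_compl_eq_one_sub hB, hB2]
      norm_num
    · change μ.real (twoSet B ⁻¹' {1}) = 1 / 2
      rw [twoSet_preimage_one, hB2]
  rw [e, clockMeasure_pi]
  have : ∀ k : Fin L, μ.real ((s^[q])^[(k : ℕ)] ⁻¹' (twoSet B ⁻¹' {a k})) = 1 / 2 := by
    intro k
    rw [((hs.iterate q).iterate k).measureReal_preimage
      (finiteMeas_twoSet hB _).nullMeasurableSet, hfib]
  simp [this]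

/-- The skew product is transported to X by an isomorphism under which a point and coordinate 0 of
its image lie in the same sets of F. -/
theorem exists_independent_perturbation [StandardBorelSpace X] {μ : Measure X}
    [IsProbabilityMeasure μ] [NullSingletonClass μ] (s : MPGroup μ) (F : Finset (Set X))
    (hF : ∀ C ∈ F, MeasurableSet C) {B : Set X} (hBF : B ∈ F) (hB2 : μ.real B = 1 / 2)
    (q L : ℕ) [NeZero q] [NeZero L] :
    ∃ e : MPGroup μ,
      (∀ C ∈ F, s.1 ⁻¹' C ∈ F → μ.real (symmDiff (e.1 ⁻¹' C) (s.1 ⁻¹' C)) ≤ 1 / q) ∧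
      partitionEntropy μ (itinerary e.1^[q] (twoSet B) L) = L * Real.log 2 := by
  classical
  have hne : Nonempty X := μ.nonempty_of_neZero
  set ν := clockMeasure q L μ with hν
  set f := clockMap q L s.1 with hf
  set f' := clockMapInv q L s.1.symm with hf'
  have hfmp : MeasurePreserving f ν ν := measurePreserving_clockMap q L s.2.1
  have hf'mp : MeasurePreserving f' ν ν := measurePreserving_clockMapInv q L s.2.2
  set P : X → (F → Bool) := fun x C => decide (x ∈ C.1) with hP
  have hPm : FiniteMeas P := by
    refine FiniteMeas.pi fun C => ?_
    have : Measurable fun x => decide (x ∈ C.1) :=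
      measurable_to_bool (by convert hF C.1 C.2 using 1; ext x; simp)
    exact fun b => this (measurableSet_singleton b)
  have hev := measurePreserving_clock_eval (μ := μ) q L
  obtain ⟨φ, ψ, hφ, hψ, hψφ, hφψ, hlab⟩ := exists_measureIso_label μ ν hPm
    (hPm.comp hev.measurable) fun a => by
      rw [Set.preimage_comp, hev.measure_preimage (hPm a).nullMeasurableSet]
  obtain ⟨e, he, -⟩ := exists_mpGroup_ae_eq (hψ.comp (hfmp.comp hφ)) (hψ.comp (hf'mp.comp hφ))
    (by
      filter_upwards [hψφ, (hf'mp.comp hφ).quasiMeasurePreserving.ae hφψ] with x h1 h2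
      simp only [Function.comp] at h2 ⊢
      rw [h2, hf, hf', clockMap_clockMapInv q L s.1.apply_symm_apply, h1])
    (by
      filter_upwards [hψφ, (hfmp.comp hφ).quasiMeasurePreserving.ae hφψ] with x h1 h2
      simp only [Function.comp] at h2 ⊢
      rw [h2, hf, hf', clockMapInv_clockMap q L s.1.symm_apply_apply, h1])
  have hstep : ∀ᵐ x ∂μ, φ (e.1 x) = f (φ x) := by
    filter_upwards [he, (hfmp.comp hφ).quasiMeasurePreserving.ae hφψ] with x h1 h2
    rw [h1]
    exact h2
  have hiter : ∀ n : ℕ, ∀ᵐ x ∂μ, φ (e.1^[n] x) = f^[n] (φ x) := by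
    intro n
    induction n with
    | zero => exact Eventually.of_forall fun _ => rfl
    | succ n ih =>
      filter_upwards [hstep, e.2.1.quasiMeasurePreserving.ae ih] with x h1 h2
      rw [Function.iterate_succ_apply, h2, h1, ← Function.iterate_succ_apply]
  have hmem : ∀ n : ℕ, ∀ᵐ x ∂μ, ∀ C ∈ F, (e.1^[n] x ∈ C ↔ (f^[n] (φ x)).2 0 ∈ C) := by
    intro n
    filter_upwards [hiter n, (e.2.1.iterate n).quasiMeasurePreserving.ae hlab] with x h1 h2 C hC
    have h3 := congrFun h2 ⟨C, hC⟩
    simp only [hP, Function.comp, h1] at h3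
    exact (decide_eq_decide.1 h3).symm
  refine ⟨e, fun C hC hC' => ?_, ?_⟩
  · have hsub : symmDiff (e.1 ⁻¹' C) (s.1 ⁻¹' C) ≤ᵐ[μ] φ ⁻¹' {p | p.1 = 0} := by
      filter_upwards [hmem 0, hmem 1] with x h0 h1 hx
      have h0' := h0 _ hC'
      have h1' := h1 _ hC
      simp only [Function.iterate_zero, id, Function.iterate_one] at h0' h1'
      by_contra hcl
      have hcl' : (φ x).1 ≠ 0 := hcl
      have hf0 : (f (φ x)).2 0 = s.1 ((φ x).2 0) := by
        simp [hf, clockMap, hcl']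
      rw [hf0] at h1'
      have hx' : x ∈ symmDiff (e.1 ⁻¹' C) (s.1 ⁻¹' C) := hx
      rw [Set.mem_symmDiff] at hx'
      simp only [Set.mem_preimage] at h0' hx'
      tauto
    have h1 : μ.real (symmDiff (e.1 ⁻¹' C) (s.1 ⁻¹' C)) ≤ μ.real (φ ⁻¹' {p | p.1 = 0}) :=
      ENNReal.toReal_mono (measure_ne_top _ _) (measure_mono_ae hsub)
    have hms : MeasurableSet {p : Fin q × (Fin L → X) | p.1 = 0} :=
      measurable_fst (measurableSet_singleton 0)
    rwa [hφ.measureReal_preimage hms.nullMeasurableSet, hν, clockMeasure_clock_eq_zero] at h1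
  · rw [← partitionEntropy_clock q L s.2.1 (hF B hBF) hB2,
      ← partitionEntropy_comp_measurePreserving _ hφ]
    · refine partitionEntropy_congr ?_
      filter_upwards [ae_all_iff.2 hmem] with x hx
      funext i
      simp only [itinerary, Function.comp, ← Function.iterate_mul]
      have := hx (q * i) B hBF
      simp only [twoSet, this]
      rfl
    · exact FiniteMeas.pi fun i => (finiteMeas_twoSet (hF B hBF)).comp
        (hev.measurable.comp ((hfmp.iterate q).iterate i).measurable)

/-! ### Conjugacy invariance and density -/

theorem partitionEntropy_itinerary_congr {μ : Measure X} {s t : MPGroup μ}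
    (h : ∀ᵐ x ∂μ, s.1 x = t.1 x) {k : ℕ} (ξ : X → Fin k) (j n : ℕ) :
    partitionEntropy μ (itinerary s.1^[j] ξ n) = partitionEntropy μ (itinerary t.1^[j] ξ n) := by
  have hit : ∀ n : ℕ, ∀ᵐ x ∂μ, s.1^[n] x = t.1^[n] x := by
    intro n
    induction n with
    | zero => exact Eventually.of_forall fun _ => rfl
    | succ n ih =>
      filter_upwards [h, t.2.1.quasiMeasurePreserving.ae ih] with x h1 h2
      rw [Function.iterate_succ_apply, Function.iterate_succ_apply, h1, h2]
  refine partitionEntropy_congr ?_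
  filter_upwards [ae_all_iff.2 hit] with x hx
  funext i
  simp only [itinerary, ← Function.iterate_mul, hx]

/-- J intertwines the conjugate with S and preserves μ. -/
theorem partitionEntropy_itinerary_conj {μ : Measure X} (S J : Aut μ) {B : Set X}
    (hB : MeasurableSet B) (j n : ℕ) :
    partitionEntropy μ (itinerary (J⁻¹ * S * J).out.1^[j] (twoSet B) n) =
      partitionEntropy μ (itinerary S.out.1^[j] (twoSet (J.out.1.symm ⁻¹' B)) n) := by
  have hmk : J⁻¹ * S * J = ((J.out⁻¹ * S.out * J.out : MPGroup μ) : Aut μ) := by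
    rw [QuotientGroup.mk_mul, QuotientGroup.mk_mul, QuotientGroup.mk_inv, QuotientGroup.out_eq',
      QuotientGroup.out_eq']
  rw [hmk, partitionEntropy_itinerary_congr (out_mk_ae_eq _),
    ← partitionEntropy_comp_measurePreserving (finiteMeas_itinerary
      (S.out.2.1.measurable.iterate j) (finiteMeas_twoSet (J.out.2.2.measurable hB)) n) J.out.2.1]
  congr 1
  funext x i
  have hsc : Function.Semiconj J.out.1 (J.out⁻¹ * S.out * J.out : MPGroup μ).1 S.out.1 := by
    intro x
    change J.out.1 (J.out.1.symm (S.out.1 (J.out.1 x))) = S.out.1 (J.out.1 x)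
    exact J.out.1.apply_symm_apply _
  have h := (hsc.iterate_right (j * i)).eq x
  simp only [itinerary, Function.comp, ← Function.iterate_mul, ← h]
  change _ = twoSet B (J.out.1.symm (J.out.1 _))
  rw [Equiv.symm_apply_apply]

/-- The cost depends on the period j + 1 alone, so the lengths may be prescribed beforehand. -/
theorem exists_independent_approximation [StandardBorelSpace X] {μ : Measure X}
    [IsProbabilityMeasure μ] [NullSingletonClass μ] (A : DenseFamily μ) (s : MPGroup μ)
    {B : Set X} (hB : MeasurableSet B) (hB2 : μ.real B = 1 / 2) {L : ℕ → ℕ} (hL : ∀ j, 0 < L j) :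
    ∃ e : ℕ → MPGroup μ, Tendsto (fun j => preDist A (e j) s) atTop (nhds 0) ∧
      ∀ j, partitionEntropy μ (itinerary (e j).1^[j + 1] (twoSet B) (L j)) =
        L j * Real.log 2 := by
  classical
  have hex : ∀ j, ∃ e : MPGroup μ, (∀ i < j, setDist μ (A.set i) e s ≤ 2 * (1 / ((j : ℝ) + 1))) ∧
      partitionEntropy μ (itinerary e.1^[j + 1] (twoSet B) (L j)) = L j * Real.log 2 := by
    intro j
    have : NeZero (L j) := ⟨(hL j).ne'⟩
    set R := Finset.range j with hR
    set F : Finset (Set X) := insert B (R.image A.set ∪ (R.image (fun i => s.1 ⁻¹' A.set i) ∪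
      R.image fun i => s.1.symm ⁻¹' A.set i)) with hF
    have hFm : ∀ C ∈ F, MeasurableSet C := by
      intro C hC
      simp only [hF, Finset.mem_insert, Finset.mem_union, Finset.mem_image] at hC
      rcases hC with rfl | ⟨i, -, rfl⟩ | ⟨i, -, rfl⟩ | ⟨i, -, rfl⟩
      · exact hB
      · exact A.measurableSet i
      · exact s.2.1.measurable (A.measurableSet i)
      · exact s.2.2.measurable (A.measurableSet i)
    obtain ⟨e, he, hent⟩ := exists_independent_perturbation s F hFm (Finset.mem_insert_self _ _)
      hB2 (j + 1) (L j)
    refine ⟨e, fun i hi => ?_, hent⟩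
    have hiR : i ∈ R := Finset.mem_range.2 hi
    have m1 : A.set i ∈ F := Finset.mem_insert_of_mem (Finset.mem_union_left _
      (Finset.mem_image_of_mem _ hiR))
    have m2 : s.1 ⁻¹' A.set i ∈ F := Finset.mem_insert_of_mem (Finset.mem_union_right _
      (Finset.mem_union_left _ (Finset.mem_image_of_mem (fun i => s.1 ⁻¹' A.set i) hiR)))
    have m3 : s.1.symm ⁻¹' A.set i ∈ F := Finset.mem_insert_of_mem (Finset.mem_union_right _
      (Finset.mem_union_right _ (Finset.mem_image_of_mem (fun i => s.1.symm ⁻¹' A.set i) hiR)))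
    have hs : s.1 ⁻¹' (s.1.symm ⁻¹' A.set i) = A.set i := by
      ext x
      simp
    have hs' : e.1 ⁻¹' (e.1.symm ⁻¹' A.set i) = A.set i := by
      ext x
      simp
    have b1 := he _ m1 m2
    -- The inverse term of the distance: the set s(A i) has s-preimage A i, and applying e turns the
    -- estimate into one between e(A i) and s(A i).
    have b2 := he _ m3 (hs.symm ▸ m1)
    have b3 := measureReal_symmDiff_preimage e.2.1 (e.2.2.measurable (A.measurableSet i))
      (s.2.2.measurable (A.measurableSet i))
    rw [hs'] at b3
    rw [hs, symmDiff_comm, b3] at b2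
    rw [setDist_eq_preimage]
    push_cast at b1 b2
    linarith
  choose e he hent using hex
  refine ⟨e, tendsto_preDist A fun i => ?_, hent⟩
  have hlim : Tendsto (fun j : ℕ => 2 * (1 / ((j : ℝ) + 1))) atTop (nhds 0) := by
    simpa using tendsto_one_div_add_atTop_nhds_zero_nat.const_mul (2 : ℝ)
  refine squeeze_zero' (Eventually.of_forall fun j => setDist_nonneg _ _ _ _) ?_ hlim
  filter_upwards [eventually_gt_atTop i] with j hj
  exact he j i hj

theorem dense_large_itinerary_entropy [StandardBorelSpace X] {μ : Measure X}
    [IsProbabilityMeasure μ] [NullSingletonClass μ] (A : DenseFamily μ) {B : Set X}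
    (hB : MeasurableSet B) (hB2 : μ.real B = 1 / 2) {L : ℕ → ℕ} (hL : ∀ j, 0 < L j) (N : ℕ) :
    letI := halmosMetricSpace A
    Dense {T : Aut μ | ∃ j ≥ N, L j * (Real.log 2 / 2) <
      partitionEntropy μ (itinerary T.out.1^[j + 1] (twoSet B) (L j))} := by
  let := halmosMetricSpace A
  intro T
  obtain ⟨e, he, hent⟩ := exists_independent_approximation A T.out hB hB2 hL
  refine mem_closure_of_tendsto (f := fun j => (e j : Aut μ)) (b := atTop) ?_ ?_
  · refine tendsto_iff_dist_tendsto_zero.2 (he.congr fun j => ?_)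
    exact (halmosDist_mk_eq_preDist_out A (e j) T).symm
  · filter_upwards [eventually_ge_atTop N] with j hj
    refine ⟨j, hj, ?_⟩
    rw [partitionEntropy_itinerary_congr (out_mk_ae_eq (e j)), hent]
    have h1 : (0 : ℝ) < L j := Nat.cast_pos.2 (hL j)
    have h2 : (0 : ℝ) < Real.log 2 := Real.log_pos one_lt_two
    exact mul_lt_mul_of_pos_left (by linarith) h1

theorem isOpen_large_itinerary_entropy [StandardBorelSpace X] {μ : Measure X}
    [IsProbabilityMeasure μ] (A : DenseFamily μ) {B : Set X} (hB : MeasurableSet B) (L : ℕ → ℕ)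
    (N : ℕ) :
    letI := halmosMetricSpace A
    IsOpen {T : Aut μ | ∃ j ≥ N, L j * (Real.log 2 / 2) <
      partitionEntropy μ (itinerary T.out.1^[j + 1] (twoSet B) (L j))} := by
  let := halmosMetricSpace A
  have e : {T : Aut μ | ∃ j ≥ N, L j * (Real.log 2 / 2) <
      partitionEntropy μ (itinerary T.out.1^[j + 1] (twoSet B) (L j))} =
      ⋃ j ≥ N, {T : Aut μ | L j * (Real.log 2 / 2) <
        partitionEntropy μ (itinerary T.out.1^[j + 1] (twoSet B) (L j))} := by
    ext T
    simp
  rw [e]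
  exact isOpen_biUnion fun j _ => isOpen_lt continuous_const
    (continuous_partitionEntropy_itinerary A (finiteMeas_twoSet hB) (j + 1) (L j))

/-- If the itinerary entropies of `S` along the progressions tend to zero for the sets of a dense
family, then they do so for every measurable set. -/
theorem eventually_itinerary_entropy_le {μ : Measure X} [IsProbabilityMeasure μ]
    (A : DenseFamily μ) {S : Aut μ} {L : ℕ → ℕ}
    (hS : ∀ j, ∀ m < j, partitionEntropy μ (itinerary S.out.1^[j + 1] (twoSet (A.set m)) (L j)) ≤
      L j * (1 / ((j : ℝ) + 1))) {C : Set X} (hC : MeasurableSet C) {ε : ℝ} (hε : 0 < ε) :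
    ∀ᶠ j in atTop,
      partitionEntropy μ (itinerary S.out.1^[j + 1] (twoSet C) (L j)) ≤ L j * ε := by
  -- Half of ε pays for replacing C by a member of the family, the other half for the bound 1 / (j +
  -- 1).
  have hbin : ∀ᶠ x in nhds (0 : ℝ), Real.binEntropy x < ε / 2 :=
    Real.binEntropy_continuous.continuousAt.eventually_lt_const (by
      rw [Real.binEntropy_zero]
      positivity)
  obtain ⟨δ, hδ, hδ'⟩ := Metric.eventually_nhds_iff.1 hbin
  obtain ⟨m, hm⟩ := A.dense C hC δ hδ
  have hsd : partitionEntropy μ (twoSet (symmDiff C (A.set m))) < ε / 2 := by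
    rw [partitionEntropy_twoSet (hC.symmDiff (A.measurableSet m))]
    refine hδ' ?_
    rw [Real.dist_eq, sub_zero, abs_of_nonneg measureReal_nonneg, symmDiff_comm]
    exact hm
  have hlim := tendsto_one_div_add_atTop_nhds_zero_nat (𝕜 := ℝ)
  filter_upwards [eventually_gt_atTop m, hlim.eventually_lt_const (half_pos hε)] with j hj hj'
  have h1 := partitionEntropy_itinerary_le_add (S.out.2.1.iterate (j + 1))
    (finiteMeas_twoSet (A.measurableSet m)) (finiteMeas_twoSet (hC.symmDiff (A.measurableSet m)))
    (fun a b => a + b) (twoSet_eq_add_symmDiff C (A.set m)) (L j)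
  have h2 := hS j m hj
  have h3 : (0 : ℝ) ≤ L j := Nat.cast_nonneg _
  have h4 := mul_le_mul_of_nonneg_left hsd.le h3
  have h5 := mul_le_mul_of_nonneg_left hj'.le h3
  linarith

theorem isMeagre_conjSaturation [StandardBorelSpace X] {μ : Measure X} [IsProbabilityMeasure μ]
    [NullSingletonClass μ] (A : DenseFamily μ) {K : Set (Aut μ)} :
    letI := halmosMetricSpace A
    IsCompact K → (∀ S ∈ K, ksEntropy S = 0) → IsMeagre (conjSaturation K) := by
  let := halmosMetricSpace A
  intro hK hK0
  obtain ⟨B, hB, hB2⟩ := exists_measureReal_eq_half μ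
  choose L hL hLK using fun j : ℕ => exists_uniform_itinerary_length A hK hK0 j (j + 1)
    (Nat.succ_pos j) (1 / ((j : ℝ) + 1)) (by positivity)
  -- The threshold (log 2) / 2 lies strictly between the generic value log 2 and the limit 0 on the
  -- saturation.
  have hres : (⋂ N, {T : Aut μ | ∃ j ≥ N, L j * (Real.log 2 / 2) <
      partitionEntropy μ (itinerary T.out.1^[j + 1] (twoSet B) (L j))}) ∈ residual (Aut μ) :=
    countable_iInter_mem.2 fun N => residual_of_dense_open
      (isOpen_large_itinerary_entropy A hB L N) (dense_large_itinerary_entropy A hB hB2 hL N)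
  refine mem_of_superset hres fun T hT => ?_
  rintro ⟨S, hS, J, rfl⟩
  have hlog : (0 : ℝ) < Real.log 2 := Real.log_pos one_lt_two
  obtain ⟨N, hN⟩ := eventually_atTop.1 (eventually_itinerary_entropy_le A
    (fun j => hLK j S hS) (J.out.2.2.measurable hB) (half_pos hlog))
  obtain ⟨j, hj, hlt⟩ := Set.mem_iInter.1 hT N
  rw [partitionEntropy_itinerary_conj S J hB] at hlt
  exact absurd (hN j hj) (not_le.2 hlt)

end HalmosAut
end

/-! ### Meagreness and non-genericity of the saturation. -/

theorem mainTheorem1 {X : Type*} [MeasurableSpace X] [StandardBorelSpace X]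
    (μ : Measure X) [IsProbabilityMeasure μ] [NullSingletonClass μ]
    (A : DenseFamily μ) (K : Set (Aut μ)) :
    letI := halmosMetricSpace A
    IsCompact K → (∀ S ∈ K, ksEntropy S = 0) →
      IsMeagre (conjSaturation K) ∧ ¬ IsGeneric (conjSaturation K) := by
  let := halmosMetricSpace A
  intro hK hK0
  have hmeagre := isMeagre_conjSaturation A hK hK0
  refine ⟨hmeagre, ?_⟩
  rintro ⟨G, hGK, hGδ, hGd⟩
  -- Completeness makes Baire's theorem available: a dense `Gδ` set cannot be meagre.
  have := completeSpace_halmos A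
  exact not_isMeagre_of_isGδ_of_dense hGδ hGd (hmeagre.mono hGK)
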